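/- Let $\Omega\subset\mathbb R^2$ be a bounded open set (for instance a bounded simply connected smooth domain), let $L>0$, and put $D=\Omega\times(0,L)\subset\mathbb R^3$. Write $x=(\hat x,x_3)$ with $\hat x=(x_1,x_2)$, $\hat A=(A^1,A^2)$, and $\vec a(x)=\tfrac12(-x_2,x_1,0)$. For an integer $N\ge1$ let $s=L/N$, $D_n=\Omega\times(ns,(n+1)s)$ for $0\le n\le N-1$, $\chi_0=\chi_{(0,s)}$ and $\chi_n=\chi_{[ns,(n+1)s)}$ for $1\le n\le N-1$. For $h_0\ge0$ let $K_0$ be the set of $\vec A\in H^1_{loc}(\mathbb R^3;\mathbb R^3)$ with $\nabla\times\vec A-h_0\vec e_3\in L^2(\mathbb R^3;\mathbb R^3)$, $\nabla\cdot\vec A=0$ and $\vec A-h_0\vec a\in\check H^1\cap L^6(\mathbb R^3;\mathbb R^3)$, where $\check H^1$ is the completion of $C_c^\infty(\mathbb R^3;\mathbb R^3)$ in the norm $\|\nabla \vec C\|_{L^2}$. Let $V$ be the set of $v\in L^2(D;\mathbb R^2)$ whose distributional curl $\operatorname{curl}v=\partial_1v^2-\partial_2v^1$ is a finite Radon measure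 on $D$, and for $(v,\vec A)\in V\times K_0$ let $$\mathcal G_{h_0}(v,\vec A)=\tfrac12\Big[\|v-\hat A\|_{L^2(D)}^2+|\operatorname{curl}v|(D)+\|\nabla\times\vec A-h_0\vec e_3\|_{L^2(\mathbb R^3)}^2\Big].$$ There is a constant $C>0$ depending only on $D$ such that the following holds. (a) Let $h_0\in\mathbb R$, $g\in L^2(D)$, $i\in\{1,2\}$, and let $A^i:\mathbb R^3\to\mathbb R$ be such that $A^i-h_0a^i$ is the Newtonian potential of $g$, that is, $A^i(x)-h_0a^i(x)=\int_D\frac{g(y)}{4\pi|x-y|}\,dy$ for all $x\in\mathbb R^3$. Then for all $\tfrac12<\alpha<1$ and all $N\ge1$, $$\sum_{n=0}^{N-1}\big\|A^i(\hat x,ns)\,\chi_n(x_3)-A^i(\hat x,x_3)\big\|_{L^2(D_n)}^2\le C\,s^{4\alpha-2}\,\|g\|_{L^2(D)}^2 .$$ In particular, the left-hand side tends to $0$ as $s=L/N\to0$. (b) Let $h_0\ge0$, let $(v_0,\vec A_0)\in V\times K_0$ be a minimizer of $\mathcal G_{h_0}$ over $V\times K_0$, let $i\in\{1,2\}$, and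 put $g^i=v_0^i-A_0^i$. Then $g^i\in L^2(D)$, $A_0^i$ has a continuous representative $A^i$ on $\mathbb R^3$, and for all $\tfrac12<\alpha<1$ and all $N\ge1$, $$\sum_{n=0}^{N-1}\big\|A^i(\hat x,ns)\,\chi_n(x_3)-A^i(\hat x,x_3)\big\|_{L^2(D_n)}^2\le C\,s^{4\alpha-2}\,\|g^i\|_{L^2(D)}^2 .$$ In particular, the left-hand side tends to $0$ as $s=L/N\to0$. -/

import Mathlib

open MeasureTheory Filter Topology Set
open scoped ENNReal ContDiff

noncomputable section

namespace LawrenceDoniach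

/-- The plane `ℝ²` with its Euclidean norm. -/
abbrev E2 : Type := EuclideanSpace ℝ (Fin 2)

/-- The space `ℝ³` with its Euclidean norm. Coordinates are numbered `0, 1, 2`, so that `x 2` is
the vertical coordinate, written `x₃` in the usual notation. -/
abbrev E3 : Type := EuclideanSpace ℝ (Fin 3)

/-! ### Geometry -/

/-- The horizontal part `x̂ = (x₁, x₂)` of a point or vector of `ℝ³`. -/
def hat (x : E3) : E2 := !₂[x 0, x 1]

/-- The point `(x̂, t)`. -/
def point (y : E2) (t : ℝ) : E3 := !₂[y 0, y 1, t]

/-- The open cylinder `D = Ω × (0, L)`. -/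
def cylinder (Ω : Set E2) (L : ℝ) : Set E3 := {x | hat x ∈ Ω ∧ x 2 ∈ Ioo 0 L}

/-- The slab `D_n = Ω × (n s, (n + 1) s)`. -/
def slab (Ω : Set E2) (s : ℝ) (n : ℕ) : Set E3 :=
  {x | hat x ∈ Ω ∧ x 2 ∈ Ioo (n * s) ((n + 1) * s)}

/-- The functions `χ_n`: the characteristic function of `(0, s)` for `n = 0`, and of
`[n s, (n + 1) s)` for `n ≥ 1`. -/
def chi (s : ℝ) (n : ℕ) : ℝ → ℝ :=
  if n = 0 then (Ioo 0 s).indicator 1 else (Ico (n * s) ((n + 1) * s)).indicator 1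

/-- The sum over the layers, for interlayer distance `s = L / N`,
`∑_{n < N} ‖u(x̂, n s) χ_n(x₃) - u(x̂, x₃)‖²_{L²(D_n)}`. -/
def layerError (Ω : Set E2) (L : ℝ) (N : ℕ) (u : E3 → ℝ) : ℝ≥0∞ :=
  ∑ n ∈ Finset.range N,
    eLpNorm (fun x => u (point (hat x) (n * (L / N))) * chi (L / N) n (x 2) - u x) 2
      (volume.restrict (slab Ω (L / N) n)) ^ 2

/-! ### The Newtonian potential and the reference field -/

/-- The Newtonian potential `x ↦ ∫_D g(y) / (4π|x - y|) dy`. -/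
def newtonPotential (D : Set E3) (g : E3 → ℝ) (x : E3) : ℝ :=
  ∫ y in D, 1 / (4 * Real.pi * dist x y) * g y

/-- The vector field `a(x) = (-x₂, x₁, 0) / 2`, whose curl is `e₃`. -/
def refField (x : E3) : E3 := !₂[-(x 1) / 2, x 0 / 2, 0]

/-! ### Weak derivatives and function spaces on `ℝ³` -/

/-- The classical partial derivative `∂_j f`. -/
def partialD {F : Type*} [NormedAddCommGroup F] [NormedSpace ℝ F]
    (j : Fin 3) (f : E3 → F) (x : E3) : F :=
  fderiv ℝ f x (EuclideanSpace.single j 1)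

/-- `φ ∈ C_c^∞(ℝ³; F)`. -/
def IsTest {F : Type*} [NormedAddCommGroup F] [NormedSpace ℝ F] (φ : E3 → F) : Prop :=
  ContDiff ℝ ∞ φ ∧ HasCompactSupport φ

/-- `f ∈ L²_loc(ℝ³; F)`. -/
def MemL2loc {F : Type*} [NormedAddCommGroup F] (f : E3 → F) : Prop :=
  ∀ K : Set E3, IsCompact K → MemLp f 2 (volume.restrict K)

/-- The function `f'` is the weak partial derivative `∂_j f` on `ℝ³`. -/
def HasWeakPartial (j : Fin 3) (f f' : E3 → ℝ) : Prop :=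
  LocallyIntegrable f ∧ LocallyIntegrable f' ∧
    ∀ φ : E3 → ℝ, IsTest φ → ∫ x, f x * partialD j φ x = -∫ x, f' x * φ x

/-- `A ∈ H¹_loc(ℝ³; ℝ³)`. -/
def MemH1loc (A : E3 → E3) : Prop :=
  MemL2loc A ∧ ∀ i j : Fin 3, ∃ f' : E3 → ℝ, MemL2loc f' ∧ HasWeakPartial j (fun x => A x i) f'

/-- The vector field `w` is the weak curl of `A` on `ℝ³`. Since indices in `Fin 3` are added modulo
`3`, the `k`-th component of the curl is `∂_{k+1} A_{k+2} - ∂_{k+2} A_{k+1}`. -/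
def HasWeakCurl (A w : E3 → E3) : Prop :=
  LocallyIntegrable A ∧ LocallyIntegrable w ∧
    ∀ (k : Fin 3) (φ : E3 → ℝ), IsTest φ →
      ∫ x, w x k * φ x =
        ∫ x, (A x (k + 1) * partialD (k + 2) φ x - A x (k + 2) * partialD (k + 1) φ x)

/-- `∇ · A = 0` on `ℝ³` in the weak sense. -/
def WeakDivFree (A : E3 → E3) : Prop :=
  ∀ φ : E3 → ℝ, IsTest φ → ∫ x, ∑ i : Fin 3, A x i * partialD i φ x = 0

/-- `A` belongs to `Ȟ¹(ℝ³; ℝ³) ∩ L⁶(ℝ³; ℝ³)`, where `Ȟ¹` is the completion of `C_c^∞(ℝ³; ℝ³)` with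
respect to `‖∇A‖_{L²}`. By the Sobolev inequality a sequence of test fields which is Cauchy for this
norm converges in `L⁶`; an element of the completion is identified with that limit. -/
def MemHCheck (A : E3 → E3) : Prop :=
  MemLp A 6 ∧
    ∃ (Φ : ℕ → E3 → E3) (G : Fin 3 → E3 → E3),
      (∀ m, IsTest (Φ m)) ∧ (∀ j, MemLp (G j) 2) ∧
      Tendsto (fun m => eLpNorm (fun x => Φ m x - A x) 6 volume) atTop (𝓝 0) ∧
      ∀ j, Tendsto (fun m => eLpNorm (fun x => partialD j (Φ m) x - G j x) 2 volume) atTop (𝓝 0)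

/-- The constant vector field `h₀ e₃`. -/
def appliedField (h₀ : ℝ) : E3 := EuclideanSpace.single 2 h₀

/-- `A ∈ E₀`: `A ∈ H¹_loc(ℝ³; ℝ³)` and `∇ × A - h₀ e₃ ∈ L²(ℝ³; ℝ³)`. -/
def MemE0 (h₀ : ℝ) (A : E3 → E3) : Prop :=
  MemH1loc A ∧ ∃ w : E3 → E3, HasWeakCurl A w ∧ MemLp (fun x => w x - appliedField h₀) 2

/-- `A ∈ K₀`: `A ∈ E₀`, `∇ · A = 0`, and `A - h₀ a ∈ Ȟ¹(ℝ³; ℝ³) ∩ L⁶(ℝ³; ℝ³)`. -/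
def MemK0 (h₀ : ℝ) (A : E3 → E3) : Prop :=
  MemE0 h₀ A ∧ WeakDivFree A ∧ MemHCheck (fun x => A x - h₀ • refField x)

/-! ### The limiting energy -/

/-- The finite signed measure `μ` on `D` is the distribution `curl v = ∂₁v₂ - ∂₂v₁` on `D`. -/
def IsCurlMeasure (D : Set E3) (v : E3 → E2) (μ : SignedMeasure D) : Prop :=
  ∀ φ : E3 → ℝ, IsTest φ → tsupport φ ⊆ D →
    (∫ x : D, φ x ∂μ.toJordanDecomposition.posPart) -
        (∫ x : D, φ x ∂μ.toJordanDecomposition.negPart) =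
      ∫ x in D, (v x 0 * partialD 1 φ x - v x 1 * partialD 0 φ x)

/-- `v ∈ V`: `v ∈ L²(D; ℝ²)` and `curl v` is a finite Radon measure on `D`. -/
def MemV (D : Set E3) (v : E3 → E2) : Prop :=
  MemLp v 2 (volume.restrict D) ∧ ∃ μ : SignedMeasure D, IsCurlMeasure D v μ

/-- The total variation `|curl v|(D)`, equal to `∞` when `curl v` is not a finite measure
(there is at most one `μ` as below). -/
def curlVariation (D : Set E3) (v : E3 → E2) : ℝ≥0∞ :=
  ⨅ (μ : SignedMeasure D) (_ : IsCurlMeasure D v μ), μ.totalVariation univ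

/-- The magnetic energy `‖∇ × A - h₀ e₃‖²_{L²(ℝ³)}`
(the weak curl is unique up to null sets). -/
def magneticEnergy (h₀ : ℝ) (A : E3 → E3) : ℝ≥0∞ :=
  ⨅ (w : E3 → E3) (_ : HasWeakCurl A w), eLpNorm (fun x => w x - appliedField h₀) 2 volume ^ 2

/-- The limiting functional
`G_{h₀}(v, A) = (‖v - Â‖²_{L²(D)} + |curl v|(D) + ‖∇ × A - h₀ e₃‖²_{L²(ℝ³)}) / 2`. -/
def limitEnergy (D : Set E3) (h₀ : ℝ) (v : E3 → E2) (A : E3 → E3) : ℝ≥0∞ :=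
  (eLpNorm (fun x => v x - hat (A x)) 2 (volume.restrict D) ^ 2 + curlVariation D v +
    magneticEnergy h₀ A) / 2

/-- `(v, A)` minimizes `G_{h₀}` over `V × K₀`. -/
def IsMinimizer (D : Set E3) (h₀ : ℝ) (v : E3 → E2) (A : E3 → E3) : Prop :=
  MemV D v ∧ MemK0 h₀ A ∧
    ∀ (v' : E3 → E2) (A' : E3 → E3), MemV D v' → MemK0 h₀ A' →
      limitEnergy D h₀ v A ≤ limitEnergy D h₀ v' A'

end LawrenceDoniach

end

open LawrenceDoniach

noncomputable section

namespace LawrenceDoniach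

/-! Potentials. The horizontal components of `refField` do not depend on x₃, so a vertical increment
of A^i is an increment of the Newtonian potential of g. If x' lies vertically above or below x at
distance at most s, then |1/|x'-y| - 1/|x-y|| ≤ s / (|x'-y| |x-y|). Both distances dominate |z₁| and
|z₂|, where z = x - y, and |x-y| also dominates |z₃|. Distributing the powers bounds the quotient by
s ∏|zᵢ|^(-2/3), a locally integrable kernel independent of x' (`abs_newtonKernel_sub_le`). The Schur
test then bounds the layer error by C s² ‖g‖² (`layerError_le`). For α < 1 this is stronger than
s^(4α-2), since s ≤ L.

Minimizers. It remains to show that A^i - h₀a^i is almost everywhere the Newtonian potential of g =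
v^i - A^i on D; this potential is continuous. The total variation term is not differentiable, but
adding a horizontal gradient to v leaves curl v unchanged. For a test field Ψ, vary v by the
horizontal gradient of div Ψ and A by curl curl Ψ = ∇ div Ψ - ΔΨ. Both variations are admissible,
and the induced variation of v - Â is the horizontal part of ΔΨ. With Ψ = φ eᵢ, the identity curl⁴ Ψ
= Δ²Ψ - ∇Δ div Ψ and div A = 0 turn the Euler–Lagrange equation into ∫ A^i Δ²φ + ∫_D g Δφ = 0
(`IsMinimizer.integral_mul_lap_lap`). Only compactly supported fields are used, at the cost of one
extra Laplacian.

That Laplacian is removed by a Liouville argument. Let u = A^i - h₀a^i, which is in L⁶; a^i is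
linear, so u solves the same equation. The Newtonian kernel cut off at scale R inverts -Δ up to
convolution with a kernel of size R⁻³ supported at scale R (`conv_truncKernel_lap`). Tested against
u, such averages are O(R^(-1/2)) by Hölder (`tendsto_integral_mul_avg`). Using the cut-off kernel
once gives -Δu = g on D extended by zero; using it again gives ∫ uψ = ∫_D g Nψ, with N the Newtonian
potential operator (`integral_mul_test_eq`). Fubini moves N onto g. -/

/-! ### The space of test functions -/

/-- The space `C_c^∞(ℝ³)` of real test functions. -/
def testSpace : Submodule ℝ (E3 → ℝ) where
  carrier := {φ | IsTest φ}
  zero_mem' := ⟨contDiff_const, HasCompactSupport.zero⟩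
  add_mem' := fun ha hb => ⟨ha.1.add hb.1, ha.2.add hb.2⟩
  smul_mem' := fun c _ ha => ⟨contDiff_const.smul ha.1, ha.2.smul_left (f := fun _ => c)⟩

/-- A real test function on `ℝ³`. -/
abbrev TestFn : Type := testSpace

instance : CoeFun TestFn fun _ => E3 → ℝ := ⟨Subtype.val⟩

theorem TestFn.contDiff (φ : TestFn) : ContDiff ℝ ∞ φ := φ.2.1
theorem TestFn.hasCompactSupport (φ : TestFn) : HasCompactSupport φ := φ.2.2
theorem TestFn.continuous (φ : TestFn) : Continuous φ := φ.contDiff.continuous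
theorem TestFn.differentiable (φ : TestFn) : Differentiable ℝ φ :=
  φ.contDiff.differentiable (by simp)
theorem TestFn.integrable (φ : TestFn) : Integrable φ :=
  φ.continuous.integrable_of_hasCompactSupport φ.hasCompactSupport
theorem TestFn.memLp (φ : TestFn) (p : ℝ≥0∞) : MemLp φ p :=
  φ.continuous.memLp_of_hasCompactSupport φ.hasCompactSupport

theorem TestFn.exists_bound (φ : TestFn) : ∃ M, 0 < M ∧ ∀ x, |φ x| ≤ M := by
  obtain ⟨M, hM⟩ := φ.continuous.bounded_above_of_compact_support φ.hasCompactSupport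
  exact ⟨max M 1, by positivity, fun x => (hM x).trans (le_max_left _ _)⟩

theorem TestFn.exists_radius (φ : TestFn) : ∃ ρ, 0 < ρ ∧ ∀ x, ρ < ‖x‖ → φ x = 0 := by
  obtain ⟨ρ, h0, h⟩ := φ.hasCompactSupport.isCompact.isBounded.exists_pos_norm_le
  exact ⟨ρ, h0, fun x hx => by
    by_contra hne
    exact absurd (h x (subset_tsupport _ hne)) (not_le.2 hx)⟩

theorem TestFn.integrable_mul (φ : TestFn) {f : E3 → ℝ} (hf : LocallyIntegrable f) :
    Integrable fun x => f x * φ x := by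
  simpa [mul_comm] using
    hf.integrable_smul_left_of_hasCompactSupport φ.continuous φ.hasCompactSupport

@[simp] theorem TestFn.add_apply (φ ψ : TestFn) (x : E3) : (φ + ψ) x = φ x + ψ x := rfl
@[simp] theorem TestFn.sub_apply (φ ψ : TestFn) (x : E3) : (φ - ψ) x = φ x - ψ x := rfl
@[simp] theorem TestFn.zero_apply (x : E3) : (0 : TestFn) x = 0 := rfl
@[simp] theorem TestFn.smul_apply (c : ℝ) (φ : TestFn) (x : E3) : (c • φ) x = c * φ x := rfl

theorem isTest_partialD {φ : E3 → ℝ} (hφ : IsTest φ) (j : Fin 3) : IsTest (partialD j φ) :=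
  ⟨(hφ.1.fderiv_right (m := ∞) (by simp)).clm_apply contDiff_const,
    hφ.2.fderiv_apply (𝕜 := ℝ) _⟩

/-- The partial derivative `∂_j` as an endomorphism of the space of test functions. -/
def dd (j : Fin 3) : TestFn →ₗ[ℝ] TestFn where
  toFun φ := ⟨partialD j φ, isTest_partialD φ.2 j⟩
  map_add' φ ψ := by
    ext x
    exact congrArg (· (EuclideanSpace.single j (1 : ℝ)))
      (fderiv_add (φ.differentiable x) (ψ.differentiable x))
  map_smul' c φ := by
    ext x
    exact congrArg (· (EuclideanSpace.single j (1 : ℝ))) (fderiv_const_smul (φ.differentiable x) c)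

theorem dd_apply (j : Fin 3) (φ : TestFn) (x : E3) : dd j φ x = partialD j φ x := rfl

theorem dd_comm (i j : Fin 3) (φ : TestFn) : dd i (dd j φ) = dd j (dd i φ) := by
  ext x
  have h2 : ContDiff ℝ 2 φ := φ.contDiff.of_le (WithTop.coe_le_coe.2 (le_top : (2 : ℕ∞) ≤ ⊤))
  have hd : DifferentiableAt ℝ (fderiv ℝ φ) x :=
    ((h2.fderiv_right (m := 1) (by norm_num)).differentiable (by norm_num)) x
  have key : ∀ v w : E3, fderiv ℝ (fun y => fderiv ℝ φ y v) x w = fderiv ℝ (fderiv ℝ φ) x w v := by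
    intro v w
    rw [fderiv_clm_apply hd (differentiableAt_const v)]
    simp
  have hs := (h2.contDiffAt (x := x)).isSymmSndFDerivAt (by simp)
  change fderiv ℝ (fun y => fderiv ℝ φ y _) x _ = fderiv ℝ (fun y => fderiv ℝ φ y _) x _
  rw [key, key]
  exact hs _ _

/-- The Laplacian on test functions. -/
def lap : TestFn →ₗ[ℝ] TestFn := ∑ j, dd j ∘ₗ dd j

theorem lap_eq (φ : TestFn) : lap φ = ∑ j, dd j (dd j φ) := by simp [lap]

theorem lap_apply (φ : TestFn) (x : E3) : lap φ x = ∑ j, dd j (dd j φ) x := by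
  rw [lap_eq]; simp [Fin.sum_univ_three]

theorem dd_lap (j : Fin 3) (φ : TestFn) : dd j (lap φ) = lap (dd j φ) := by
  simp only [lap_eq, map_sum]
  exact Finset.sum_congr rfl fun i _ => by rw [dd_comm j i, dd_comm j i]

/-- Integration by parts against a test function. -/
theorem integral_mul_dd {f : E3 → ℝ} (hf : ContDiff ℝ 1 f) (j : Fin 3) (φ : TestFn) :
    ∫ x, f x * dd j φ x = -∫ x, partialD j f x * φ x := by
  have hc : Continuous (partialD j f) := by
    unfold partialD
    exact (hf.continuous_fderiv (by norm_num)).clm_apply continuous_const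
  exact integral_mul_fderiv_eq_neg_fderiv_mul_of_integrable
    (φ.integrable_mul hc.locallyIntegrable)
    ((dd j φ).integrable_mul hf.continuous.locallyIntegrable)
    (φ.integrable_mul hf.continuous.locallyIntegrable)
    (fun x _ => hf.differentiable (by norm_num) x) (fun x _ => φ.differentiable x)

theorem integral_dd (j : Fin 3) (φ : TestFn) : ∫ x, dd j φ x = 0 := by
  have := integral_mul_dd (f := fun _ => (1 : ℝ)) contDiff_const j φ
  simpa [partialD] using this

/-! ### Divergence and curl of test fields -/

/-- The divergence of a test field, given by its components. -/
def divT (X : Fin 3 → TestFn) : TestFn := ∑ i, dd i (X i)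

/-- The curl of a test field, given by its components. -/
def curlT (X : Fin 3 → TestFn) (k : Fin 3) : TestFn :=
  dd (k + 1) (X (k + 2)) - dd (k + 2) (X (k + 1))

theorem divT_curlT (X : Fin 3 → TestFn) : divT (curlT X) = 0 := by
  simp only [divT, curlT, Fin.sum_univ_three, map_sub, Fin.isValue, Fin.reduceAdd, zero_add]
  rw [dd_comm 1 0, dd_comm 2 0, dd_comm 2 1]
  abel

theorem curlT_curlT (X : Fin 3 → TestFn) (k : Fin 3) :
    curlT (curlT X) k = dd k (divT X) - lap (X k) := by
  fin_cases k <;>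
  simp only [divT, curlT, lap_eq, Fin.sum_univ_three, map_sub, map_add, Fin.isValue, Fin.reduceAdd,
    zero_add, Fin.zero_eta, Fin.mk_one, Fin.reduceFinMk] 
  · rw [dd_comm 1 0, dd_comm 2 0]; abel
  · rw [dd_comm 1 0, dd_comm 2 1]; abel
  · rw [dd_comm 2 0, dd_comm 2 1]; abel

/-- The fourfold curl of a test field. -/
theorem curlT_curlT_curlT_curlT (X : Fin 3 → TestFn) (k : Fin 3) :
    curlT (curlT (curlT (curlT X))) k = lap (lap (X k)) - dd k (lap (divT X)) := by
  rw [curlT_curlT, divT_curlT, map_zero, zero_sub, curlT_curlT, map_sub, dd_lap]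
  abel

/-! ### Convolution of an integrable kernel with a test function -/

/-- The convolution of a compactly supported integrable kernel with a test function. -/
def conv {G : E3 → ℝ} (hG : Integrable G) (hc : HasCompactSupport G) (φ : TestFn) : TestFn :=
  ⟨convolution G φ (ContinuousLinearMap.mul ℝ ℝ) volume,
    φ.hasCompactSupport.contDiff_convolution_right (n := ⊤) _ hG.locallyIntegrable φ.contDiff,
    HasCompactSupport.convolution _ hc φ.hasCompactSupport⟩

theorem conv_apply {G : E3 → ℝ} (hG : Integrable G) (hc : HasCompactSupport G) (φ : TestFn)
    (x : E3) : conv hG hc φ x = ∫ y, G y * φ (x - y) := rfl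

/-- The kernel is only integrable, so the derivative has to fall on the test function. This lets
`conv` commute with the Laplacian while staying inside `TestFn`. -/
theorem dd_conv {G : E3 → ℝ} (hG : Integrable G) (hc : HasCompactSupport G) (j : Fin 3)
    (φ : TestFn) : dd j (conv hG hc φ) = conv hG hc (dd j φ) := by
  ext x
  have h := φ.hasCompactSupport.hasFDerivAt_convolution_right (ContinuousLinearMap.mul ℝ ℝ)
    hG.locallyIntegrable (φ.contDiff.of_le (mod_cast le_top)) x
  have hi : Integrable fun t => (ContinuousLinearMap.precompR E3 (ContinuousLinearMap.mul ℝ ℝ))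
      (G t) (fderiv ℝ φ (x - t)) := by
    exact (φ.hasCompactSupport.fderiv (𝕜 := ℝ)).convolutionExists_right
      ((ContinuousLinearMap.mul ℝ ℝ).precompR E3) hG.locallyIntegrable
      (φ.contDiff.continuous_fderiv (by simp)) x
  change fderiv ℝ (convolution G φ (ContinuousLinearMap.mul ℝ ℝ) volume) x _ = _
  rw [h.fderiv, conv_apply, convolution, ContinuousLinearMap.integral_apply hi]
  rfl

theorem lap_conv {G : E3 → ℝ} (hG : Integrable G) (hc : HasCompactSupport G)
    (φ : TestFn) : lap (conv hG hc φ) = conv hG hc (lap φ) := by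
  have hadd : ∀ a b : TestFn, conv hG hc (a + b) = conv hG hc a + conv hG hc b := by
    intro a b
    apply Subtype.ext
    exact ConvolutionExists.distrib_add
      (a.hasCompactSupport.convolutionExists_right _ hG.locallyIntegrable a.continuous)
      (b.hasCompactSupport.convolutionExists_right _ hG.locallyIntegrable b.continuous)
  simp only [lap_eq, Fin.sum_univ_three, hadd, dd_conv]

/-! ### A radial profile: the inverse square root, smoothly cut off -/

/-- The function `τ ↦ τ^{-1/2}` cut off smoothly between `1` and `2`. -/
def profile (τ : ℝ) : ℝ := τ ^ (-1 / 2 : ℝ) * Real.smoothTransition (2 - τ)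

/-- The difference between the second derivative of `profile` and that of `τ ↦ τ^{-1/2}`. -/
def profileRem (τ : ℝ) : ℝ :=
  if τ < 1 then 0 else deriv (deriv profile) τ - 3 / 4 * τ ^ (-5 / 2 : ℝ)

/-- The function `q` for which `Δ (profile ‖·‖²) = q(‖·‖²)` away from the origin. -/
def profileLap (τ : ℝ) : ℝ :=
  if τ < 1 then 0 else 4 * τ * deriv (deriv profile) τ + 6 * deriv profile τ

theorem profile_of_le {τ : ℝ} (h : τ ≤ 1) : profile τ = τ ^ (-1 / 2 : ℝ) := by
  rw [profile, Real.smoothTransition.one_of_one_le (by linarith), mul_one]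

theorem profile_of_ge {τ : ℝ} (h : 2 ≤ τ) : profile τ = 0 := by
  rw [profile, Real.smoothTransition.zero_of_nonpos (by linarith), mul_zero]

theorem abs_profile_le {τ : ℝ} (h : 0 ≤ τ) : |profile τ| ≤ τ ^ (-1 / 2 : ℝ) := by
  have h0 := Real.rpow_nonneg h (-1 / 2 : ℝ)
  have h1 := Real.smoothTransition.nonneg (2 - τ)
  rw [profile, abs_of_nonneg (mul_nonneg h0 h1)]
  exact mul_le_of_le_one_right h0 (Real.smoothTransition.le_one _)

theorem contDiffAt_profile {τ : ℝ} (h : 0 < τ) : ContDiffAt ℝ ∞ profile τ := by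
  unfold profile
  refine (Real.contDiffAt_rpow_const_of_ne h.ne').mul ?_
  exact Real.smoothTransition.contDiffAt.comp τ (contDiffAt_const.sub contDiffAt_id)

theorem contDiffOn_profile : ContDiffOn ℝ ∞ profile (Ioi 0) := fun _ h =>
  (contDiffAt_profile h).contDiffWithinAt

theorem contDiffOn_deriv_profile : ContDiffOn ℝ ∞ (deriv profile) (Ioi 0) :=
  contDiffOn_profile.deriv_of_isOpen isOpen_Ioi (by simp)

theorem contDiffOn_deriv_deriv_profile : ContDiffOn ℝ ∞ (deriv (deriv profile)) (Ioi 0) :=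
  contDiffOn_deriv_profile.deriv_of_isOpen isOpen_Ioi (by simp)

theorem hasDerivAt_profile {τ : ℝ} (h : 0 < τ) : HasDerivAt profile (deriv profile τ) τ :=
  ((contDiffAt_profile h).differentiableAt (by simp)).hasDerivAt

theorem hasDerivAt_deriv_profile {τ : ℝ} (h : 0 < τ) :
    HasDerivAt (deriv profile) (deriv (deriv profile) τ) τ :=
  ((contDiffOn_deriv_profile.contDiffAt (Ioi_mem_nhds h)).differentiableAt (by simp)).hasDerivAt

theorem deriv_profile_of_lt {τ : ℝ} (h : τ < 1) :
    deriv profile τ = -1 / 2 * τ ^ (-3 / 2 : ℝ) := by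
  have he : profile =ᶠ[𝓝 τ] fun t => t ^ (-1 / 2 : ℝ) :=
    Filter.mem_of_superset (Iio_mem_nhds h) fun t ht => profile_of_le (le_of_lt ht)
  rw [he.deriv_eq, Real.deriv_rpow_const]
  norm_num

theorem deriv_deriv_profile_of_lt {τ : ℝ} (h0 : 0 < τ) (h : τ < 1) :
    deriv (deriv profile) τ = 3 / 4 * τ ^ (-5 / 2 : ℝ) := by
  have he : deriv profile =ᶠ[𝓝 τ] fun t => -1 / 2 * t ^ (-3 / 2 : ℝ) :=
    Filter.mem_of_superset (Ioo_mem_nhds h0 h) fun t ht => deriv_profile_of_lt ht.2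
  rw [he.deriv_eq, deriv_const_mul _ (Real.hasDerivAt_rpow_const (Or.inl h0.ne')).differentiableAt,
    Real.deriv_rpow_const]
  norm_num
  ring

/-- The power τ^(-5/2) is the part that concentrates into a Dirac mass in
`integral_profile_mul_lap`; the remainder is continuous and bounded. -/
theorem deriv_deriv_profile {τ : ℝ} (h : 0 < τ) :
    deriv (deriv profile) τ = 3 / 4 * τ ^ (-5 / 2 : ℝ) + profileRem τ := by
  unfold profileRem
  split_ifs with h1
  · rw [deriv_deriv_profile_of_lt h h1, add_zero]
  · ring

/-- For τ < 1 the two terms are 3τ^(-3/2) and -3τ^(-3/2) and cancel: with τ = ‖y‖² the profile is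
‖y‖⁻¹, which is harmonic off the origin in dimension three. -/
theorem profileLap_eq {τ : ℝ} (h : 0 < τ) :
    4 * τ * deriv (deriv profile) τ + 6 * deriv profile τ = profileLap τ := by
  unfold profileLap
  split_ifs with h1
  · rw [deriv_deriv_profile_of_lt h h1, deriv_profile_of_lt h1]
    have : τ ^ (-3 / 2 : ℝ) = τ ^ (-5 / 2 : ℝ) * τ := by
      rw [← Real.rpow_add_one h.ne']; norm_num
    rw [this]; ring
  · rfl

theorem deriv_profile_of_gt {τ : ℝ} (h : 2 < τ) : deriv profile τ = 0 := by
  have he : profile =ᶠ[𝓝 τ] fun _ => 0 := Filter.mem_of_superset (Ioi_mem_nhds h) fun t ht => profile_of_ge ht.le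
  rw [he.deriv_eq]; simp

theorem deriv_deriv_profile_of_gt {τ : ℝ} (h : 2 < τ) : deriv (deriv profile) τ = 0 := by
  have he : deriv profile =ᶠ[𝓝 τ] fun _ => 0 :=
    Filter.mem_of_superset (Ioi_mem_nhds h) fun t ht => deriv_profile_of_gt ht
  rw [he.deriv_eq]; simp

theorem profileLap_of_gt {τ : ℝ} (h : 2 < τ) : profileLap τ = 0 := by
  rw [← profileLap_eq (by linarith), deriv_profile_of_gt h, deriv_deriv_profile_of_gt h]; simp

/-- Intended for `profileLap` and `profileRem`: the profile is smooth only on (0, ∞), and the value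
zero below 1 carries these functions continuously across the origin. -/
theorem continuous_of_continuousOn_Ioi {f : ℝ → ℝ} (h0 : ContinuousOn f (Ioi 0))
    (h1 : ∀ τ < 1, f τ = 0) : Continuous f := by
  rw [continuous_iff_continuousAt]
  intro τ
  by_cases h : 0 < τ
  · exact h0.continuousAt (Ioi_mem_nhds h)
  · have he : f =ᶠ[𝓝 τ] fun _ => 0 :=
      Filter.mem_of_superset (Iio_mem_nhds (show τ < 1 by linarith)) fun t ht => h1 t ht
    exact continuousAt_const.congr he.symm

theorem continuous_profileLap : Continuous profileLap := by
  refine continuous_of_continuousOn_Ioi ?_ fun τ h => if_pos h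
  refine ContinuousOn.congr (f := fun τ => 4 * τ * deriv (deriv profile) τ + 6 * deriv profile τ)
    ?_ fun τ h => (profileLap_eq h).symm
  have h1 := contDiffOn_deriv_profile.continuousOn
  have h2 := contDiffOn_deriv_deriv_profile.continuousOn
  fun_prop

theorem continuous_profileRem : Continuous profileRem := by
  refine continuous_of_continuousOn_Ioi ?_ fun τ h => if_pos h
  refine ContinuousOn.congr (f := fun τ => deriv (deriv profile) τ - 3 / 4 * τ ^ (-5 / 2 : ℝ))
    ?_ fun τ h => by beta_reduce; rw [deriv_deriv_profile h]; ring
  have h2 := contDiffOn_deriv_deriv_profile.continuousOn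
  refine h2.sub (continuousOn_const.mul ?_)
  exact continuousOn_id.rpow_const fun x hx => Or.inl (ne_of_gt hx)

theorem exists_profileLap_bound : ∃ M, 0 < M ∧ ∀ τ, |profileLap τ| ≤ M := by
  have hc : HasCompactSupport profileLap :=
    HasCompactSupport.intro (K := Icc 1 2) isCompact_Icc fun τ hτ => by
      rcases lt_or_ge τ 1 with h | h
      · exact if_pos h
      · exact profileLap_of_gt (by by_contra h2; exact hτ ⟨h, not_lt.1 h2⟩)
  obtain ⟨M, hM⟩ := continuous_profileLap.bounded_above_of_compact_support hc
  exact ⟨max M 1, by positivity, fun x => (hM x).trans (le_max_left _ _)⟩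

theorem exists_profileRem_bound : ∃ M, 0 < M ∧ ∀ τ, |profileRem τ| ≤ M := by
  obtain ⟨M, hM⟩ := isCompact_Icc.exists_bound_of_continuousOn
    (s := Icc (1 : ℝ) 2) continuous_profileRem.continuousOn
  refine ⟨max M 1, by positivity, fun τ => ?_⟩
  rcases lt_or_ge τ 1 with h | h
  · rw [profileRem, if_pos h, abs_zero]; positivity
  rcases le_or_gt τ 2 with h2 | h2
  · exact (hM τ ⟨h, h2⟩).trans (le_max_left _ _)
  · refine le_trans ?_ (le_max_right _ _)
    rw [profileRem, if_neg (by linarith), deriv_deriv_profile_of_gt h2, zero_sub, abs_neg,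
      abs_of_nonneg (by positivity)]
    have := Real.rpow_le_one_of_one_le_of_nonpos h (show (-5 / 2 : ℝ) ≤ 0 by norm_num)
    linarith

/-! ### The fundamental solution -/

/-- In polar coordinates the radial integrand r²(1 + r²)^(-5/2) has the primitive r³(1 + r²)^(-3/2)
/ 3. Three times this integral is the constant 4π of the fundamental solution. -/
theorem integral_one_add_norm_sq_rpow :
    ∫ z : E3, (1 + ‖z‖ ^ 2) ^ (-5 / 2 : ℝ) = 4 * Real.pi / 3 := by
  have hI : ∫ y in Ioi (0 : ℝ), y ^ 2 * (1 + y ^ 2) ^ (-5 / 2 : ℝ) = 1 / 3 := by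
    have hd : ∀ y ∈ Ioi (0 : ℝ), HasDerivAt (fun y : ℝ => 1 / 3 * (y ^ 3 * (1 + y ^ 2) ^ (-3 / 2 : ℝ)))
        (y ^ 2 * (1 + y ^ 2) ^ (-5 / 2 : ℝ)) y := by
      intro y hy
      have hpos : 0 < 1 + y ^ 2 := by positivity
      have h1 : HasDerivAt (fun y : ℝ => 1 + y ^ 2) (2 * y) y := by
        simpa using (hasDerivAt_pow 2 y).const_add 1
      have h2 := h1.rpow_const (p := (-3 / 2 : ℝ)) (Or.inl hpos.ne')
      have h3 := ((hasDerivAt_pow 3 y).mul h2).const_mul (1 / 3 : ℝ)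
      refine h3.congr_deriv ?_
      have e1 : (1 + y ^ 2) ^ (-3 / 2 : ℝ) = (1 + y ^ 2) ^ (-5 / 2 : ℝ) * (1 + y ^ 2) := by
        rw [← Real.rpow_add_one hpos.ne']; norm_num
      have e2 : (-3 / 2 - 1 : ℝ) = -5 / 2 := by norm_num
      rw [e2, e1]
      simp only [Nat.cast_ofNat]
      ring
    have hlim : Tendsto (fun y : ℝ => 1 / 3 * (y ^ 3 * (1 + y ^ 2) ^ (-3 / 2 : ℝ))) atTop
        (𝓝 (1 / 3)) := by
      have h0 : Tendsto (fun y : ℝ => 1 / 3 * ((1 + (y ^ 2)⁻¹) ^ (-3 / 2 : ℝ))) atTop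
          (𝓝 (1 / 3 * ((1 + 0) ^ (-3 / 2 : ℝ)))) := by
        refine Tendsto.const_mul _ (Tendsto.rpow_const ?_ (Or.inl (by norm_num)))
        exact tendsto_const_nhds.add (tendsto_pow_atTop (by norm_num)).inv_tendsto_atTop
      simp only [add_zero, Real.one_rpow, mul_one] at h0
      refine h0.congr' ?_
      filter_upwards [eventually_gt_atTop 0] with y hy
      congr 1
      have : 1 + (y ^ 2)⁻¹ = (1 + y ^ 2) * (y ^ 2)⁻¹ := by field_simp; ring
      rw [this, Real.mul_rpow (by positivity) (by positivity), mul_comm]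
      congr 1
      rw [Real.inv_rpow (by positivity), ← Real.rpow_natCast, ← Real.rpow_mul hy.le,
        ← Real.rpow_neg hy.le, ← Real.rpow_natCast]
      norm_num
    have := integral_Ioi_of_hasDerivAt_of_nonneg (a := 0)
      (g := fun y : ℝ => 1 / 3 * (y ^ 3 * (1 + y ^ 2) ^ (-3 / 2 : ℝ))) ?_ hd ?_ hlim
    · rw [this]; simp
    · refine Continuous.continuousWithinAt ?_
      refine continuous_const.mul ((continuous_pow 3).mul ?_)
      exact (continuous_const.add (continuous_pow 2)).rpow_const fun x =>
        Or.inl (show (0 : ℝ) < 1 + x ^ 2 by positivity).ne'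
    · intro x _; positivity
  have h := integral_fun_norm_addHaar (volume : Measure E3)
    (fun r : ℝ => (1 + r ^ 2) ^ (-5 / 2 : ℝ))
  rw [h]
  simp only [finrank_euclideanSpace, Fintype.card_fin, Nat.add_one_sub_one, smul_eq_mul, hI]
  have hv : (volume : Measure E3).real (Metric.ball 0 1) = 4 * Real.pi / 3 := by
    rw [Measure.real, EuclideanSpace.volume_ball_fin_three, ENNReal.ofReal_one, one_pow, one_mul,
      ENNReal.toReal_ofReal (by positivity)]
    ring
  rw [hv]; norm_num; ring

theorem hasFDerivAt_radial {h : ℝ → ℝ} {h' c : ℝ} {y : E3} (hh : HasDerivAt h h' (‖y‖ ^ 2 + c)) :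
    HasFDerivAt (fun y : E3 => h (‖y‖ ^ 2 + c)) (h' • (2 • innerSL ℝ y)) y :=
  hh.comp_hasFDerivAt y ((hasStrictFDerivAt_norm_sq y).hasFDerivAt.add_const c)

theorem partialD_radial {h : ℝ → ℝ} {h' c : ℝ} {y : E3} (hh : HasDerivAt h h' (‖y‖ ^ 2 + c))
    (j : Fin 3) : partialD j (fun y : E3 => h (‖y‖ ^ 2 + c)) y = h' * (2 * y j) := by
  rw [partialD, (hasFDerivAt_radial hh).fderiv]
  simp [EuclideanSpace.inner_single_right]

/-- The shift by c makes the profile smooth at the origin, so two integrations by parts are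
legitimate. With τ = ‖y‖² + c, the Laplacian of h(τ) is 4‖y‖²h'' + 6h', and ‖y‖² = τ - c yields the
correction -4c h''. -/
theorem integral_profile_reg {c : ℝ} (hc : 0 < c) (φ : TestFn) :
    ∫ y : E3, profile (‖y‖ ^ 2 + c) * lap φ y =
      ∫ y : E3, (profileLap (‖y‖ ^ 2 + c) - 4 * c * deriv (deriv profile) (‖y‖ ^ 2 + c)) * φ y := by
  have hpos : ∀ y : E3, 0 < ‖y‖ ^ 2 + c := fun y => by positivity
  have hin : ContDiff ℝ ∞ fun y : E3 => ‖y‖ ^ 2 + c := (contDiff_norm_sq ℝ).add contDiff_const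
  have hcomp : ∀ {h : ℝ → ℝ}, ContDiffOn ℝ ∞ h (Ioi 0) →
      ContDiff ℝ ∞ fun y : E3 => h (‖y‖ ^ 2 + c) := fun {h} hh =>
    contDiff_iff_contDiffAt.2 fun y =>
      ContDiffAt.comp (f := fun y : E3 => ‖y‖ ^ 2 + c) y
        (hh.contDiffAt (Ioi_mem_nhds (hpos y))) hin.contDiffAt
  have h0 := hcomp contDiffOn_profile
  have h1 := hcomp contDiffOn_deriv_profile
  have h2 := hcomp contDiffOn_deriv_deriv_profile
  have hcoord : ∀ j : Fin 3, ContDiff ℝ ∞ fun y : E3 => y j := fun j =>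
    (EuclideanSpace.proj (𝕜 := ℝ) j).contDiff
  have hpj : ∀ j : Fin 3, partialD j (fun y : E3 => profile (‖y‖ ^ 2 + c)) =
      fun y => deriv profile (‖y‖ ^ 2 + c) * (2 * y j) := fun j => by
    ext y; exact partialD_radial (hasDerivAt_profile (hpos y)) j
  have hg1 : ∀ j : Fin 3, ContDiff ℝ ∞ fun y : E3 => deriv profile (‖y‖ ^ 2 + c) * (2 * y j) :=
    fun j => h1.mul (contDiff_const.mul (hcoord j))
  have hpjj : ∀ j : Fin 3, partialD j (fun y : E3 => deriv profile (‖y‖ ^ 2 + c) * (2 * y j)) =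
      fun y => deriv (deriv profile) (‖y‖ ^ 2 + c) * (4 * y j ^ 2) +
        2 * deriv profile (‖y‖ ^ 2 + c) := fun j => by
    ext y
    have e := (hasFDerivAt_radial (hasDerivAt_deriv_profile (hpos y))).mul
      ((EuclideanSpace.proj (𝕜 := ℝ) j : E3 →L[ℝ] ℝ).hasFDerivAt.const_mul 2 (x := y))
    rw [partialD]
    erw [e.fderiv]
    simp [EuclideanSpace.inner_single_right]
    ring
  have hj : ∀ j : Fin 3, ∫ y : E3, profile (‖y‖ ^ 2 + c) * dd j (dd j φ) y =
      ∫ y : E3, (deriv (deriv profile) (‖y‖ ^ 2 + c) * (4 * y j ^ 2) +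
        2 * deriv profile (‖y‖ ^ 2 + c)) * φ y := fun j => by
    rw [integral_mul_dd (h0.of_le (by simp)), hpj j,
      integral_mul_dd ((hg1 j).of_le (by simp)), hpjj j, neg_neg]
  simp only [lap_apply, Finset.mul_sum]
  rw [integral_finsetSum _ fun j _ => (dd j (dd j φ)).integrable_mul
    h0.continuous.locallyIntegrable]
  simp only [hj]
  have hint : ∀ j : Fin 3, LocallyIntegrable fun y : E3 =>
      deriv (deriv profile) (‖y‖ ^ 2 + c) * (4 * y j ^ 2) + 2 * deriv profile (‖y‖ ^ 2 + c) :=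
    fun j => ((h2.mul (contDiff_const.mul ((hcoord j).pow 2))).add
      (contDiff_const.mul h1)).continuous.locallyIntegrable
  rw [← integral_finsetSum _ fun j _ => φ.integrable_mul (hint j)]
  refine integral_congr_ae (Eventually.of_forall fun y => ?_)
  have hn : ‖y‖ ^ 2 = ∑ j, y j ^ 2 := by
    rw [EuclideanSpace.norm_sq_eq]; simp
  simp only [← profileLap_eq (hpos y), ← Finset.sum_mul]
  congr 1
  rw [Fin.sum_univ_three] at hn ⊢
  rw [hn]; ring

theorem integrableOn_inv_norm_ball (r : ℝ) :
    IntegrableOn (fun y : E3 => ‖y‖⁻¹) (Metric.ball 0 r) := by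
  rw [integrableOn_fun_norm_addHaar (volume : Measure E3) (f := fun t : ℝ => t⁻¹)]
  have : IntegrableOn (fun y : ℝ => y) (Ioo 0 r) :=
    (continuous_id.integrableOn_Icc (a := 0) (b := r)).mono_set Ioo_subset_Icc_self
  refine this.congr_fun (fun y hy => ?_) measurableSet_Ioo
  have : y ≠ 0 := hy.1.ne'
  simp [pow_two]

theorem integrable_inv_norm_mul (φ : TestFn) : Integrable fun y : E3 => ‖y‖⁻¹ * |φ y| := by
  obtain ⟨M, hM, hb⟩ := φ.exists_bound
  obtain ⟨ρ, hρ, hs⟩ := φ.exists_radius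
  have h1 : Integrable ((Metric.ball (0 : E3) (ρ + 1)).indicator fun y : E3 => ‖y‖⁻¹ * M) :=
    IntegrableOn.integrable_indicator ((integrableOn_inv_norm_ball (ρ + 1)).mul_const M)
      measurableSet_ball
  refine h1.mono' ?_ (Eventually.of_forall fun y => ?_)
  · exact (measurable_norm.inv.mul (continuous_abs.comp φ.continuous).measurable).aestronglyMeasurable
  · rw [Real.norm_of_nonneg (by positivity)]
    by_cases hy : y ∈ Metric.ball (0 : E3) (ρ + 1)
    · rw [indicator_of_mem hy]
      exact mul_le_mul_of_nonneg_left (hb y) (by positivity)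
    · rw [indicator_of_notMem hy, hs y, abs_zero, mul_zero]
      rw [mem_ball_zero_iff] at hy; linarith

theorem rpow_neg_half_sq (y : E3) : (‖y‖ ^ 2) ^ (-1 / 2 : ℝ) = ‖y‖⁻¹ := by
  rw [← Real.rpow_natCast, ← Real.rpow_mul (norm_nonneg y)]
  norm_num [Real.rpow_neg_one]

/-- Let c = ε² tend to zero in `integral_profile_reg`. The bounded parts converge by domination,
while the singular part of 4c h'' is the approximate identity 3ε²(‖y‖² + ε²)^(-5/2) of total mass
4π. -/
theorem integral_profile_mul_lap (φ : TestFn) :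
    ∫ y : E3, profile (‖y‖ ^ 2) * lap φ y =
      (∫ y : E3, profileLap (‖y‖ ^ 2) * φ y) - 4 * Real.pi * φ 0 := by
  obtain ⟨ε, -, hε0, hε⟩ := exists_seq_strictAnti_tendsto (0 : ℝ)
  obtain ⟨Mq, hMq, hq⟩ := exists_profileLap_bound
  obtain ⟨Mr, hMr, hr⟩ := exists_profileRem_bound
  obtain ⟨Mφ, hMφ, hφ⟩ := φ.exists_bound
  have hc : Tendsto (fun n => ε n ^ 2) atTop (𝓝 0) := by simpa using hε.pow 2
  have hcy : ∀ y : E3, Tendsto (fun n => ‖y‖ ^ 2 + ε n ^ 2) atTop (𝓝 (‖y‖ ^ 2)) := fun y => by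
    simpa using hc.const_add (‖y‖ ^ 2)
  have hpos : ∀ n, ∀ y : E3, 0 < ‖y‖ ^ 2 + ε n ^ 2 := fun n y => by
    have := hε0 n
    positivity
  have hnsq : Continuous fun y : E3 => ‖y‖ ^ 2 := by fun_prop
  -- the left-hand side
  have hL : Tendsto (fun n => ∫ y : E3, profile (‖y‖ ^ 2 + ε n ^ 2) * lap φ y) atTop
      (𝓝 (∫ y : E3, profile (‖y‖ ^ 2) * lap φ y)) := by
    refine tendsto_integral_of_dominated_convergence (fun y => ‖y‖⁻¹ * |lap φ y|) ?_
      (integrable_inv_norm_mul _) ?_ ?_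
    · intro n
      refine Continuous.aestronglyMeasurable (Continuous.mul ?_ (lap φ).continuous)
      exact contDiffOn_profile.continuousOn.comp_continuous (by fun_prop) (hpos n)
    · intro n
      have h0 : ∀ᵐ y : E3, y ≠ 0 := by simp [ae_iff]
      filter_upwards [h0] with y hy
      rw [norm_mul, Real.norm_eq_abs, Real.norm_eq_abs]
      refine mul_le_mul_of_nonneg_right ((abs_profile_le (hpos n y).le).trans ?_) (abs_nonneg _)
      rw [← rpow_neg_half_sq]
      exact Real.rpow_le_rpow_of_nonpos (by positivity) (by nlinarith [sq_nonneg (ε n)])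
        (by norm_num)
    · have h0 : ∀ᵐ y : E3, y ≠ 0 := by simp [ae_iff]
      filter_upwards [h0] with y hy
      refine Tendsto.mul_const _ ?_
      exact ((contDiffAt_profile (by positivity : 0 < ‖y‖ ^ 2)).continuousAt.tendsto).comp (hcy y)
  -- the regular part of the right-hand side
  have hR1 : Tendsto (fun n => ∫ y : E3, (profileLap (‖y‖ ^ 2 + ε n ^ 2) -
      4 * ε n ^ 2 * profileRem (‖y‖ ^ 2 + ε n ^ 2)) * φ y) atTop
      (𝓝 (∫ y : E3, (profileLap (‖y‖ ^ 2) - 4 * 0 * profileRem (‖y‖ ^ 2)) * φ y)) := by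
    obtain ⟨B, hB⟩ := hc.bddAbove_range
    have hB' : ∀ n, ε n ^ 2 ≤ B := fun n => hB ⟨n, rfl⟩
    refine tendsto_integral_of_dominated_convergence (fun y => (Mq + 4 * B * Mr) * |φ y|) ?_
      (φ.integrable.abs.const_mul _) ?_ ?_
    · intro n
      refine Continuous.aestronglyMeasurable (Continuous.mul ?_ φ.continuous)
      exact (continuous_profileLap.comp (by fun_prop)).sub
        (continuous_const.mul (continuous_profileRem.comp (by fun_prop)))
    · refine fun n => Eventually.of_forall fun y => ?_
      rw [norm_mul, Real.norm_eq_abs, Real.norm_eq_abs]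
      refine mul_le_mul_of_nonneg_right ((abs_sub _ _).trans (add_le_add (hq _) ?_)) (abs_nonneg _)
      rw [abs_mul, abs_of_nonneg (by positivity : 0 ≤ 4 * ε n ^ 2)]
      have := hB' n
      have h4 : 0 ≤ ε n ^ 2 := sq_nonneg _
      exact mul_le_mul (by linarith) (hr _) (abs_nonneg _) (by linarith)
    · refine Eventually.of_forall fun y => Tendsto.mul_const _ ?_
      exact ((continuous_profileLap.tendsto _).comp (hcy y)).sub
        ((hc.const_mul 4).mul ((continuous_profileRem.tendsto _).comp (hcy y)))
  -- the singular part
  have hS : ∀ n, ∫ y : E3, 3 * ε n ^ 2 * (‖y‖ ^ 2 + ε n ^ 2) ^ (-5 / 2 : ℝ) * φ y =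
      ∫ z : E3, 3 * (1 + ‖z‖ ^ 2) ^ (-5 / 2 : ℝ) * φ (ε n • z) := by
    intro n
    have he := hε0 n
    have h := Measure.integral_comp_smul (volume : Measure E3)
      (fun y => 3 * ε n ^ 2 * (‖y‖ ^ 2 + ε n ^ 2) ^ (-5 / 2 : ℝ) * φ y) (ε n)
    simp only [finrank_euclideanSpace, Fintype.card_fin, smul_eq_mul] at h
    rw [abs_of_pos (by positivity), eq_comm, inv_mul_eq_iff_eq_mul₀ (by positivity)] at h
    rw [h, ← integral_const_mul]
    refine integral_congr_ae (Eventually.of_forall fun z => ?_)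
    have e : ‖ε n • z‖ ^ 2 + ε n ^ 2 = ε n ^ 2 * (1 + ‖z‖ ^ 2) := by
      rw [norm_smul, mul_pow, Real.norm_eq_abs, sq_abs]; ring
    have e2 : (ε n ^ 2) ^ (-5 / 2 : ℝ) = (ε n ^ 5)⁻¹ := by
      rw [← Real.rpow_natCast, ← Real.rpow_mul he.le, ← Real.rpow_natCast, ← Real.rpow_neg he.le]
      norm_num
    simp only [e]
    rw [Real.mul_rpow (by positivity) (by positivity), e2]
    field_simp
  have hint : Integrable fun z : E3 => (1 + ‖z‖ ^ 2) ^ (-5 / 2 : ℝ) := by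
    have := integrable_rpow_neg_one_add_norm_sq (E := E3) (μ := volume) (r := 5) (by simp; norm_num)
    simpa using this
  have hR2 : Tendsto (fun n => ∫ z : E3, 3 * (1 + ‖z‖ ^ 2) ^ (-5 / 2 : ℝ) * φ (ε n • z)) atTop
      (𝓝 (∫ z : E3, 3 * (1 + ‖z‖ ^ 2) ^ (-5 / 2 : ℝ) * φ 0)) := by
    refine tendsto_integral_of_dominated_convergence
      (fun z : E3 => 3 * (1 + ‖z‖ ^ 2) ^ (-5 / 2 : ℝ) * Mφ) ?_ ((hint.const_mul 3).mul_const _) ?_ ?_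
    · intro n
      exact ((hint.const_mul 3).aestronglyMeasurable).mul
        (φ.continuous.comp (continuous_const_smul (ε n))).aestronglyMeasurable
    · refine fun n => Eventually.of_forall fun z => ?_
      rw [norm_mul, Real.norm_of_nonneg (by positivity)]
      exact mul_le_mul_of_nonneg_left (hφ _) (by positivity)
    · refine Eventually.of_forall fun z => Tendsto.const_mul _ ?_
      have : Tendsto (fun n => ε n • z) atTop (𝓝 ((0 : ℝ) • z)) := hε.smul_const z
      rw [zero_smul] at this
      exact (φ.continuous.tendsto 0).comp this
  have hval : ∫ z : E3, 3 * (1 + ‖z‖ ^ 2) ^ (-5 / 2 : ℝ) * φ 0 = 4 * Real.pi * φ 0 := by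
    rw [integral_mul_const, integral_const_mul, integral_one_add_norm_sq_rpow]; ring
  have hsplit : ∀ n, ∫ y : E3, profile (‖y‖ ^ 2 + ε n ^ 2) * lap φ y =
      (∫ y : E3, (profileLap (‖y‖ ^ 2 + ε n ^ 2) -
        4 * ε n ^ 2 * profileRem (‖y‖ ^ 2 + ε n ^ 2)) * φ y) -
      ∫ z : E3, 3 * (1 + ‖z‖ ^ 2) ^ (-5 / 2 : ℝ) * φ (ε n • z) := by
    intro n
    have he := hε0 n
    rw [integral_profile_reg (by positivity), ← hS n, ← integral_sub]
    · refine integral_congr_ae (Eventually.of_forall fun y => ?_)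
      simp only [deriv_deriv_profile (hpos n y)]
      ring
    · refine φ.integrable_mul (Continuous.locallyIntegrable ?_)
      exact (continuous_profileLap.comp (by fun_prop)).sub
        (continuous_const.mul (continuous_profileRem.comp (by fun_prop)))
    · refine φ.integrable_mul (Continuous.locallyIntegrable (continuous_const.mul ?_))
      exact (by fun_prop : Continuous fun y : E3 => ‖y‖ ^ 2 + ε n ^ 2).rpow_const
        fun y => Or.inl (hpos n y).ne'
  have hR := hR1.sub hR2
  simp only [← hsplit, hval, mul_zero, zero_mul, sub_zero] at hR
  exact tendsto_nhds_unique hL hR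

/-! ### Cut-off kernels at scale R -/

/-- The test function `y ↦ φ (x - R • y)`. -/
def reflScale (φ : TestFn) (x : E3) {R : ℝ} (hR : R ≠ 0) : TestFn :=
  ⟨fun y => φ (x - R • y), φ.contDiff.comp (contDiff_const.sub (contDiff_id.const_smul R)),
    φ.hasCompactSupport.comp_homeomorph
      ((Homeomorph.smulOfNeZero R hR).trans (Homeomorph.subLeft x))⟩

/-- With y ↦ φ(x - R y) as test function, the identity at the origin and at unit scale becomes the
convolution identity at x and scale R. -/
theorem dd_reflScale (φ : TestFn) (x : E3) {R : ℝ} (hR : R ≠ 0) (j : Fin 3) :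
    dd j (reflScale φ x hR) = (-R) • reflScale (dd j φ) x hR := by
  ext y
  have h1 : HasFDerivAt (fun y : E3 => x - R • y) (-(R • ContinuousLinearMap.id ℝ E3)) y :=
    ((hasFDerivAt_id y).const_smul R).const_sub x
  have h2 := ((φ.differentiable (x - R • y)).hasFDerivAt.comp y h1).fderiv
  change fderiv ℝ (φ ∘ fun y => x - R • y) y _ = _
  rw [h2]
  simp [reflScale, dd_apply, partialD]

theorem lap_reflScale (φ : TestFn) (x : E3) {R : ℝ} (hR : R ≠ 0) (y : E3) :
    lap (reflScale φ x hR) y = R ^ 2 * lap φ (x - R • y) := by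
  simp only [lap_apply, dd_reflScale, map_smul, TestFn.smul_apply, Finset.mul_sum]
  refine Finset.sum_congr rfl fun j _ => ?_
  simp only [reflScale]
  ring

/-- The Newtonian kernel `1 / (4π‖y‖)`, smoothly cut off at distance of order `R`. -/
def truncKernel (R : ℝ) (y : E3) : ℝ := (4 * Real.pi)⁻¹ * (R⁻¹ * profile (‖R⁻¹ • y‖ ^ 2))

/-- The regular part of the Laplacian of `truncKernel`. -/
def avgKernel (R : ℝ) (y : E3) : ℝ := (4 * Real.pi)⁻¹ * (R⁻¹ ^ 3 * profileLap (‖R⁻¹ • y‖ ^ 2))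

theorem norm_inv_smul {R : ℝ} (hR : 0 < R) (y : E3) : ‖R⁻¹ • y‖ = R⁻¹ * ‖y‖ := by
  rw [norm_smul, Real.norm_of_nonneg (by positivity)]

theorem truncKernel_eq {R : ℝ} (hR : 0 < R) {y : E3} (hy : ‖y‖ ≤ R) :
    truncKernel R y = 1 / (4 * Real.pi * ‖y‖) := by
  have h1 : R⁻¹ * ‖y‖ ≤ 1 := by
    rw [inv_mul_le_iff₀ hR]; linarith
  rw [truncKernel, profile_of_le, rpow_neg_half_sq, norm_inv_smul hR]
  · field_simp
  · rw [norm_inv_smul hR]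
    exact pow_le_one₀ (by positivity) h1

/-- The cut-off already vanishes once ‖R⁻¹ y‖² reaches 2; the radius 2R is a convenient larger
choice. -/
theorem four_le_of_lt {R : ℝ} (hR : 0 < R) {y : E3} (hy : 2 * R < ‖y‖) : 4 < ‖R⁻¹ • y‖ ^ 2 := by
  have h1 : 2 < R⁻¹ * ‖y‖ := by
    rw [lt_inv_mul_iff₀ hR]; linarith
  rw [norm_inv_smul hR]; nlinarith

theorem truncKernel_eq_zero {R : ℝ} (hR : 0 < R) {y : E3} (hy : 2 * R < ‖y‖) :
    truncKernel R y = 0 := by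
  have := four_le_of_lt hR hy
  rw [truncKernel, profile_of_ge (by linarith), mul_zero, mul_zero]

theorem avgKernel_eq_zero {R : ℝ} (hR : 0 < R) {y : E3} (hy : 2 * R < ‖y‖) :
    avgKernel R y = 0 := by
  have := four_le_of_lt hR hy
  rw [avgKernel, profileLap_of_gt (by linarith), mul_zero, mul_zero]

theorem hasCompactSupport_of_radius {f : E3 → ℝ} {ρ : ℝ} (h : ∀ y, ρ < ‖y‖ → f y = 0) :
    HasCompactSupport f :=
  HasCompactSupport.intro (isCompact_closedBall (0 : E3) ρ) fun y hy =>
    h y (by rw [mem_closedBall_zero_iff] at hy; exact not_le.1 hy)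

theorem hasCompactSupport_truncKernel {R : ℝ} (hR : 0 < R) : HasCompactSupport (truncKernel R) :=
  hasCompactSupport_of_radius fun _ => truncKernel_eq_zero hR

theorem hasCompactSupport_avgKernel {R : ℝ} (hR : 0 < R) : HasCompactSupport (avgKernel R) :=
  hasCompactSupport_of_radius fun _ => avgKernel_eq_zero hR

theorem integrable_avgKernel {R : ℝ} (hR : 0 < R) : Integrable (avgKernel R) := by
  refine Continuous.integrable_of_hasCompactSupport ?_ (hasCompactSupport_avgKernel hR)
  exact continuous_const.mul (continuous_const.mul (continuous_profileLap.comp (by fun_prop)))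

theorem measurable_profile : Measurable profile := by
  unfold profile
  exact (measurable_id.pow_const _).mul
    (Real.smoothTransition.continuous.measurable.comp (measurable_const.sub measurable_id))

theorem abs_truncKernel_le {R : ℝ} (hR : 0 < R) (y : E3) :
    |truncKernel R y| ≤ 1 / (4 * Real.pi * ‖y‖) := by
  have h := abs_profile_le (sq_nonneg ‖R⁻¹ • y‖)
  rw [rpow_neg_half_sq, norm_inv_smul hR, mul_inv, inv_inv] at h
  rw [truncKernel, abs_mul, abs_mul, abs_of_pos (by positivity : 0 < (4 * Real.pi)⁻¹),
    abs_of_pos (by positivity : 0 < R⁻¹), norm_inv_smul hR]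
  calc _ ≤ (4 * Real.pi)⁻¹ * (R⁻¹ * (R * ‖y‖⁻¹)) := by gcongr
    _ = _ := by field_simp

theorem integrable_truncKernel {R : ℝ} (hR : 0 < R) : Integrable (truncKernel R) := by
  have h1 : Integrable ((Metric.ball (0 : E3) (2 * R + 1)).indicator
      fun y : E3 => (4 * Real.pi)⁻¹ * ‖y‖⁻¹) :=
    IntegrableOn.integrable_indicator ((integrableOn_inv_norm_ball (2 * R + 1)).const_mul _)
      measurableSet_ball
  refine h1.mono' ?_ (Eventually.of_forall fun y => ?_)
  · have : Measurable (truncKernel R) := by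
      unfold truncKernel
      exact measurable_const.mul (measurable_const.mul (measurable_profile.comp (by fun_prop)))
    exact this.aestronglyMeasurable
  · by_cases hy : y ∈ Metric.ball (0 : E3) (2 * R + 1)
    · rw [indicator_of_mem hy]
      refine (abs_truncKernel_le hR y).trans_eq ?_
      rw [one_div, mul_inv]
    · rw [indicator_of_notMem hy, truncKernel_eq_zero hR, norm_zero]
      rw [mem_ball_zero_iff] at hy; linarith

/-- The truncated Newtonian kernel inverts the Laplacian up to an averaging operator. -/
theorem conv_truncKernel_lap {R : ℝ} (hR : 0 < R) (φ : TestFn) :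
    conv (integrable_truncKernel hR) (hasCompactSupport_truncKernel hR) (lap φ) =
      conv (integrable_avgKernel hR) (hasCompactSupport_avgKernel hR) φ - φ := by
  ext x
  rw [TestFn.sub_apply, conv_apply, conv_apply]
  have h := integral_profile_mul_lap (reflScale φ x hR.ne')
  -- The substitution z = R y. Its Jacobian R³ meets the prefactor R⁻¹ of `truncKernel`, leaving the
  -- R² of `lap_reflScale`, and cancels the prefactor R⁻³ of `avgKernel`.
  have key : ∀ (p : ℝ → ℝ) (f : E3 → ℝ), ∫ z, p (‖R⁻¹ • z‖ ^ 2) * f (x - z) =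
      R ^ 3 * ∫ y : E3, p (‖y‖ ^ 2) * f (x - R • y) := by
    intro p f
    have := Measure.integral_comp_inv_smul (volume : Measure E3)
      (fun y => p (‖y‖ ^ 2) * f (x - R • y)) R
    simp only [finrank_euclideanSpace, Fintype.card_fin, smul_eq_mul, smul_inv_smul₀ hR.ne'] at this
    rw [this, abs_of_pos (by positivity)]
  simp only [lap_reflScale] at h
  have e1 : ∫ y, truncKernel R y * lap φ (x - y) =
      (4 * Real.pi)⁻¹ * ∫ y : E3, profile (‖y‖ ^ 2) * (R ^ 2 * lap φ (x - R • y)) := by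
    have : ∀ y : E3, profile (‖y‖ ^ 2) * (R ^ 2 * lap φ (x - R • y)) =
      R ^ 2 * (profile (‖y‖ ^ 2) * lap φ (x - R • y)) := fun y => by ring
    simp only [this, truncKernel, mul_assoc, integral_const_mul]
    rw [key]; field_simp
  have e2 : ∫ y, avgKernel R y * φ (x - y) =
      (4 * Real.pi)⁻¹ * ∫ y : E3, profileLap (‖y‖ ^ 2) * φ (x - R • y) := by
    simp only [avgKernel, mul_assoc, integral_const_mul]
    rw [key]; field_simp
  rw [e1, e2, h]
  simp only [reflScale, smul_zero, sub_zero]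
  have := Real.pi_pos
  field_simp

theorem lap_conv_truncKernel {R : ℝ} (hR : 0 < R) (φ : TestFn) :
    lap (conv (integrable_truncKernel hR) (hasCompactSupport_truncKernel hR) φ) =
      conv (integrable_avgKernel hR) (hasCompactSupport_avgKernel hR) φ - φ := by
  rw [lap_conv, conv_truncKernel_lap hR]

/-- Averages of a test function over scale `R` are of size `R⁻³`. -/
theorem exists_avg_bound (φ : TestFn) : ∃ c, 0 < c ∧ ∀ (R : ℝ) (hR : 0 < R) (x : E3),
    |conv (integrable_avgKernel hR) (hasCompactSupport_avgKernel hR) φ x| ≤ c * R⁻¹ ^ 3 := by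
  obtain ⟨M, hM, hq⟩ := exists_profileLap_bound
  have h0 : 0 ≤ ∫ y : E3, |φ y| := integral_nonneg fun y => abs_nonneg _
  refine ⟨M * ((∫ y : E3, |φ y|) + 1), by positivity, fun R hR x => ?_⟩
  rw [conv_apply]
  have hint : Integrable fun y : E3 => |φ (x - y)| := (φ.integrable.comp_sub_left x).abs
  have hk : ∀ y, |avgKernel R y| ≤ M * R⁻¹ ^ 3 := by
    intro y
    have hpi : (4 * Real.pi)⁻¹ ≤ 1 := inv_le_one_of_one_le₀ (by nlinarith [Real.pi_gt_three])
    rw [avgKernel, abs_mul, abs_mul, abs_of_pos (by positivity : 0 < (4 * Real.pi)⁻¹),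
      abs_of_pos (by positivity : 0 < R⁻¹ ^ 3)]
    calc _ ≤ 1 * (R⁻¹ ^ 3 * M) := by gcongr; exact hq _
      _ = _ := by ring
  calc |∫ y, avgKernel R y * φ (x - y)| ≤ ∫ y : E3, M * R⁻¹ ^ 3 * |φ (x - y)| := by
        rw [← Real.norm_eq_abs]
        refine norm_integral_le_of_norm_le (hint.const_mul _) (Eventually.of_forall fun y => ?_)
        rw [norm_mul]
        exact mul_le_mul_of_nonneg_right (hk y) (abs_nonneg _)
    _ = M * R⁻¹ ^ 3 * ∫ y : E3, |φ y| := by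
        rw [integral_const_mul, integral_sub_left_eq_self (fun y : E3 => |φ y|) volume x]
    _ ≤ _ := by
        have : 0 < M * R⁻¹ ^ 3 := by positivity
        nlinarith

/-- The average over scale `R` of a test function is supported in a ball of radius of order `R`. -/
theorem avg_eq_zero {φ : TestFn} {ρ : ℝ} (hρ : ∀ x, ρ < ‖x‖ → φ x = 0) {R : ℝ} (hR : 0 < R)
    {x : E3} (hx : 2 * R + ρ < ‖x‖) :
    conv (integrable_avgKernel hR) (hasCompactSupport_avgKernel hR) φ x = 0 := by
  rw [conv_apply]
  refine integral_eq_zero_of_ae (Eventually.of_forall fun y => ?_)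
  rcases le_or_gt ‖y‖ (2 * R) with h | h
  · have : ρ < ‖x - y‖ := by
      have := norm_sub_norm_le x y
      linarith
    simp [hρ _ this]
  · simp [avgKernel_eq_zero hR h]

/-! ### A locally integrable kernel of product form -/

/-- The kernel `∏ᵢ |zᵢ|^{-2/3}`, which dominates `‖z‖⁻²` and vertical difference quotients of
`‖z‖⁻¹`. -/
def prodKernel (z : E3) : ℝ≥0∞ := ∏ i, ENNReal.ofReal |z i| ^ (-(2 / 3) : ℝ)

theorem measurable_prodKernel : Measurable prodKernel := by
  unfold prodKernel
  fun_prop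

theorem prodKernel_of_ne {z : E3} (hz : ∀ i, z i ≠ 0) :
    prodKernel z = ENNReal.ofReal (∏ i, |z i| ^ (-(2 / 3) : ℝ)) := by
  rw [ENNReal.ofReal_prod_of_nonneg fun i _ => by positivity]
  exact Finset.prod_congr rfl fun i _ => ENNReal.ofReal_rpow_of_pos (abs_pos.2 (hz i))

/-- Pointwise bounds by the kernel are thus trivial on the coordinate planes. No factor vanishes, so
the product with ⊤ is indeed ⊤. -/
theorem prodKernel_of_eq_zero {z : E3} {i : Fin 3} (hz : z i = 0) : prodKernel z = ⊤ := by
  rw [prodKernel, ← Finset.mul_prod_erase _ _ (Finset.mem_univ i)]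
  have h : ENNReal.ofReal |z i| ^ (-(2 / 3) : ℝ) = ⊤ := by simp [hz]
  rw [h]
  refine ENNReal.top_mul (Finset.prod_ne_zero_iff.2 fun j _ => ?_)
  rw [Ne, ENNReal.rpow_eq_zero_iff]
  simp
  norm_num

/-- The cube `{z | ∀ i, |zᵢ| ≤ M}`. -/
def cube (M : ℝ) : Set E3 := {z | ∀ i, |z i| ≤ M}

theorem measurableSet_cube (M : ℝ) : MeasurableSet (cube M) := by
  have : cube M = ⋂ i, {z : E3 | |z i| ≤ M} := by ext; simp [cube]
  rw [this]
  exact MeasurableSet.iInter fun i => measurableSet_le (by fun_prop) measurable_const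

theorem integrableOn_abs_rpow_ball (r : ℝ) :
    IntegrableOn (fun t : ℝ => |t| ^ (-(2 / 3) : ℝ)) (Metric.ball 0 r) := by
  have h := integrableOn_fun_norm_addHaar (volume : Measure ℝ) (r := r)
    (f := fun t : ℝ => t ^ (-(2 / 3) : ℝ))
  simp only [Real.norm_eq_abs] at h
  rw [h]
  rcases le_or_gt r 0 with hr | hr
  · simp [Ioo_eq_empty (not_lt.2 hr)]
  have h2 := (intervalIntegral.intervalIntegrable_rpow' (a := 0) (b := r)
    (show (-1 : ℝ) < -(2 / 3) by norm_num)).1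
  simpa using h2.mono_set (fun x hx => ⟨hx.1, hx.2.le⟩ : Ioo 0 r ⊆ Ioc 0 r)

/-- By Fubini this reduces to the integrability of |t|^(-2/3) near zero, which holds because 2/3 <
1. -/
theorem lintegral_cube_prodKernel_lt_top (M : ℝ) : ∫⁻ z in cube M, prodKernel z < ⊤ := by
  -- Radius M + 1, so that the open ball contains the closed interval [-M, M].
  set f : ℝ → ℝ := (Metric.ball (0 : ℝ) (M + 1)).indicator fun t => |t| ^ (-(2 / 3) : ℝ)
  have hf : Integrable f :=
    IntegrableOn.integrable_indicator (integrableOn_abs_rpow_ball _) measurableSet_ball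
  have hprod : Integrable (fun x : Fin 3 → ℝ => ∏ i, f (x i)) := Integrable.fintype_prod fun _ => hf
  have hE : Integrable fun z : E3 => ∏ i, f (z i) :=
    (PiLp.volume_preserving_ofLp (Fin 3)).integrable_comp_of_integrable hprod
  have hne : ∀ᵐ z : E3, ∀ i, z i ≠ 0 := by
    have h1 : ∀ᵐ x : Fin 3 → ℝ, ∀ i, x i ≠ 0 :=
      ae_all_iff.2 fun i => Measure.ae_eval_ne (fun _ => (volume : Measure ℝ)) i 0
    exact (PiLp.volume_preserving_ofLp (Fin 3)).quasiMeasurePreserving.ae h1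
  refine lt_of_le_of_lt ?_ hE.lintegral_lt_top
  rw [← lintegral_indicator (measurableSet_cube M)]
  refine lintegral_mono_ae ?_
  filter_upwards [hne] with z hz
  by_cases h : z ∈ cube M
  · rw [indicator_of_mem h, prodKernel_of_ne hz]
    refine ENNReal.ofReal_le_ofReal (le_of_eq (Finset.prod_congr rfl fun i _ => ?_))
    have : z i ∈ Metric.ball (0 : ℝ) (M + 1) := by
      rw [mem_ball_zero_iff, Real.norm_eq_abs]
      linarith [h i]
    simp only [f, indicator_of_mem this]
  · rw [indicator_of_notMem h]; exact zero_le

theorem setLIntegral_prodKernel_le {D : Set E3} (hD : MeasurableSet D) {x : E3} {M : ℝ}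
    (hM : ∀ y ∈ D, x - y ∈ cube M) :
    ∫⁻ y in D, prodKernel (x - y) ≤ ∫⁻ z in cube M, prodKernel z := by
  rw [← lintegral_indicator hD, ← lintegral_indicator (measurableSet_cube M),
    ← lintegral_sub_left_eq_self ((cube M).indicator prodKernel) x]
  refine lintegral_mono fun y => ?_
  by_cases h : y ∈ D
  · rw [indicator_of_mem h, indicator_of_mem (hM y h)]
  · rw [indicator_of_notMem h]; exact zero_le

theorem exists_sub_mem_cube {D : Set E3} (hD : Bornology.IsBounded D) :
    ∃ M, ∀ x ∈ D, ∀ y ∈ D, x - y ∈ cube M := by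
  obtain ⟨M, hM⟩ := Metric.isBounded_iff.1 hD
  refine ⟨M, fun x hx y hy i => ?_⟩
  have h1 := PiLp.norm_apply_le (x - y) i
  have h2 := hM hx hy
  rw [dist_eq_norm] at h2
  exact h1.trans h2

theorem setLIntegral_prodKernel_lt_top {D : Set E3} (hD : MeasurableSet D)
    (hb : Bornology.IsBounded D) (x : E3) : ∫⁻ y in D, prodKernel (x - y) < ⊤ := by
  obtain ⟨M, hM⟩ := exists_sub_mem_cube (hb.insert x)
  exact (setLIntegral_prodKernel_le hD
    fun y hy => hM x (mem_insert x D) y (mem_insert_of_mem x hy)).trans_lt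
      (lintegral_cube_prodKernel_lt_top M)

/-! ### Pointwise kernel bounds and the Schur test -/

/-- The Newtonian kernel. -/
def newtonKernel (x y : E3) : ℝ := 1 / (4 * Real.pi * dist x y)

theorem newtonKernel_comm (x y : E3) : newtonKernel x y = newtonKernel y x := by
  rw [newtonKernel, dist_comm, newtonKernel]

theorem newtonKernel_nonneg (x y : E3) : 0 ≤ newtonKernel x y := by
  unfold newtonKernel; positivity

theorem measurable_newtonKernel : Measurable fun p : E3 × E3 => newtonKernel p.1 p.2 := by
  unfold newtonKernel; fun_prop

theorem newtonKernel_le (x y : E3) : newtonKernel x y ≤ (dist x y)⁻¹ := by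
  rw [newtonKernel, one_div, mul_inv]
  refine mul_le_of_le_one_left (by positivity) (inv_le_one_of_one_le₀ ?_)
  linarith [Real.pi_gt_three]

theorem abs_coord_le_dist (x y : E3) (i : Fin 3) : |(x - y) i| ≤ dist x y := by
  rw [dist_eq_norm]; exact PiLp.norm_apply_le (x - y) i

/-- With r the distance, r⁻² is the product of three factors r^(-2/3), and each coordinate of x - y
is at most r in absolute value. -/
theorem sq_newtonKernel_le (x y : E3) :
    ENNReal.ofReal (newtonKernel x y ^ 2) ≤ prodKernel (x - y) := by
  by_cases h : ∀ i, (x - y) i ≠ 0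
  swap
  · push Not at h
    obtain ⟨i, hi⟩ := h
    rw [prodKernel_of_eq_zero hi]; exact le_top
  rw [prodKernel_of_ne h]
  refine ENNReal.ofReal_le_ofReal ?_
  have hpos : 0 < dist x y := (abs_pos.2 (h 0)).trans_le (abs_coord_le_dist x y 0)
  calc newtonKernel x y ^ 2 ≤ (dist x y)⁻¹ ^ 2 :=
        pow_le_pow_left₀ (newtonKernel_nonneg x y) (newtonKernel_le x y) 2
    _ = ∏ _i : Fin 3, dist x y ^ (-(2 / 3) : ℝ) := by
        rw [Finset.prod_const, Finset.card_univ, Fintype.card_fin, ← Real.rpow_natCast (_ ^ _),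
          ← Real.rpow_mul hpos.le, inv_pow, ← Real.rpow_natCast, ← Real.rpow_neg hpos.le]
        norm_num
    _ ≤ _ := Finset.prod_le_prod (fun i _ => by positivity) fun i _ =>
        Real.rpow_le_rpow_of_nonpos (abs_pos.2 (h i)) (abs_coord_le_dist x y i) (by norm_num)

/-- Vertical difference quotients of the Newtonian kernel are dominated by `prodKernel`. -/
theorem abs_newtonKernel_sub_le {x x' : E3} (h0 : x' 0 = x 0) (h1 : x' 1 = x 1) {s : ℝ}
    (hs : 0 < s) (hd : dist x' x ≤ s) (y : E3) :
    ENNReal.ofReal |newtonKernel x' y - newtonKernel x y| ≤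
      ENNReal.ofReal s * prodKernel (x - y) := by
  by_cases h : ∀ i, (x - y) i ≠ 0
  swap
  · push Not at h
    obtain ⟨i, hi⟩ := h
    rw [prodKernel_of_eq_zero hi, ENNReal.mul_top (by simpa using hs)]; exact le_top
  rw [prodKernel_of_ne h, ← ENNReal.ofReal_mul hs.le]
  refine ENNReal.ofReal_le_ofReal ?_
  have ha : ∀ i, |(x - y) i| ≤ dist x y := abs_coord_le_dist x y
  have hb0 : |(x - y) 0| ≤ dist x' y := by
    simpa [h0] using abs_coord_le_dist x' y 0
  have hb1 : |(x - y) 1| ≤ dist x' y := by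
    simpa [h1] using abs_coord_le_dist x' y 1
  have hz : ∀ i, 0 < |(x - y) i| := fun i => abs_pos.2 (h i)
  set a := dist x y
  set b := dist x' y
  have hapos : 0 < a := (hz 0).trans_le (ha 0)
  have hbpos : 0 < b := (hz 0).trans_le hb0
  have hab : |a - b| ≤ s := by
    refine le_trans ?_ hd
    rw [dist_comm x' x]
    exact abs_dist_sub_le x x' y
  have hk : |newtonKernel x' y - newtonKernel x y| ≤ s * (a⁻¹ * b⁻¹) := by
    have e : newtonKernel x' y - newtonKernel x y = (4 * Real.pi)⁻¹ * ((a - b) * (a⁻¹ * b⁻¹)) := by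
      change 1 / (4 * Real.pi * b) - 1 / (4 * Real.pi * a) = _
      have := Real.pi_pos
      field_simp
    rw [e, abs_mul, abs_mul, abs_of_pos (by positivity : 0 < (4 * Real.pi)⁻¹),
      abs_of_pos (by positivity : 0 < a⁻¹ * b⁻¹)]
    have hpi : (4 * Real.pi)⁻¹ ≤ 1 := inv_le_one_of_one_le₀ (by nlinarith [Real.pi_gt_three])
    calc _ ≤ 1 * (s * (a⁻¹ * b⁻¹)) := by gcongr
      _ = _ := one_mul _
  refine hk.trans (mul_le_mul_of_nonneg_left ?_ hs.le)
  -- Each of the first two coordinates is dominated by both a and b, the third only by a. Hence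
  -- a⁻¹b⁻¹ is split into two equal factors of total degree -2/3 that contain all of b, and a
  -- remaining a^(-2/3) for the vertical coordinate.
  have hsplit : a⁻¹ * b⁻¹ = (a ^ (-(1 / 6) : ℝ) * b ^ (-(1 / 2) : ℝ)) *
      (a ^ (-(1 / 6) : ℝ) * b ^ (-(1 / 2) : ℝ)) * a ^ (-(2 / 3) : ℝ) := by
    have e1 : a⁻¹ = a ^ (-(1 / 6) : ℝ) * a ^ (-(1 / 6) : ℝ) * a ^ (-(2 / 3) : ℝ) := by
      rw [← Real.rpow_add hapos, ← Real.rpow_add hapos, ← Real.rpow_neg_one]; norm_num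
    have e2 : b⁻¹ = b ^ (-(1 / 2) : ℝ) * b ^ (-(1 / 2) : ℝ) := by
      rw [← Real.rpow_add hbpos, ← Real.rpow_neg_one]; norm_num
    rw [e1, e2]; ring
  have hpair : ∀ t : ℝ, 0 < t → t ≤ a → t ≤ b →
      a ^ (-(1 / 6) : ℝ) * b ^ (-(1 / 2) : ℝ) ≤ t ^ (-(2 / 3) : ℝ) := by
    intro t ht hta htb
    have e : t ^ (-(2 / 3) : ℝ) = t ^ (-(1 / 6) : ℝ) * t ^ (-(1 / 2) : ℝ) := by
      rw [← Real.rpow_add ht]; norm_num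
    rw [e]
    exact mul_le_mul (Real.rpow_le_rpow_of_nonpos ht hta (by norm_num))
      (Real.rpow_le_rpow_of_nonpos ht htb (by norm_num)) (by positivity) (by positivity)
  rw [hsplit, Fin.prod_univ_three]
  exact mul_le_mul (mul_le_mul (hpair _ (hz 0) (ha 0) hb0) (hpair _ (hz 1) (ha 1) hb1)
    (by positivity) (by positivity))
    (Real.rpow_le_rpow_of_nonpos (hz 2) (ha 2) (by norm_num)) (by positivity) (by positivity)

/-- `‖f‖²_{L²}` as an integral. -/
theorem eLpNorm_two_sq_eq {α F : Type*} [MeasurableSpace α] [NormedAddCommGroup F] (f : α → F)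
    (μ : Measure α) : eLpNorm f 2 μ ^ 2 = ∫⁻ x, ‖f x‖ₑ ^ 2 ∂μ := by
  have h := eLpNorm_nnreal_pow_eq_lintegral (f := f) (μ := μ) (p := 2) (by norm_num)
  simpa using h

theorem memLp_newtonKernel {D : Set E3} (hD : MeasurableSet D) (hb : Bornology.IsBounded D)
    (x : E3) : MemLp (newtonKernel x) 2 (volume.restrict D) := by
  have hm : Measurable (newtonKernel x) := by unfold newtonKernel; fun_prop
  refine ⟨hm.aestronglyMeasurable, ?_⟩
  have h2 : ∫⁻ y in D, ‖newtonKernel x y‖ₑ ^ 2 < ⊤ := by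
    refine lt_of_le_of_lt (lintegral_mono fun y => ?_) (setLIntegral_prodKernel_lt_top hD hb x)
    rw [Real.enorm_of_nonneg (newtonKernel_nonneg x y),
      ← ENNReal.ofReal_pow (newtonKernel_nonneg x y)]
    exact sq_newtonKernel_le x y
  rw [← eLpNorm_two_sq_eq] at h2
  exact (ENNReal.pow_lt_top_iff.1 h2).resolve_right (by norm_num)

theorem integrableOn_newtonKernel_mul {D : Set E3} (hD : MeasurableSet D)
    (hb : Bornology.IsBounded D) {g : E3 → ℝ} (hg : MemLp g 2 (volume.restrict D)) (x : E3) :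
    IntegrableOn (fun y => newtonKernel x y * g y) D :=
  (memLp_newtonKernel hD hb x).integrable_mul hg

/-- The Schur test for `prodKernel`. -/
theorem schur_prodKernel {D : Set E3} (hD : MeasurableSet D) {M : ℝ}
    (hM : ∀ x ∈ D, ∀ y ∈ D, x - y ∈ cube M) {h : E3 → ℝ≥0∞}
    (hh : AEMeasurable h (volume.restrict D)) :
    ∫⁻ x in D, (∫⁻ y in D, prodKernel (x - y) * h y) ^ 2 ≤
      (∫⁻ z in cube M, prodKernel z) ^ 2 * ∫⁻ y in D, h y ^ 2 := by
  set K := ∫⁻ z in cube M, prodKernel z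
  have hPx : ∀ x : E3, Measurable fun y => prodKernel (x - y) := fun x =>
    measurable_prodKernel.comp (measurable_const.sub measurable_id)
  -- Cauchy–Schwarz after writing P h = √P · (√P h). The integral of P over D is at most K,
  -- uniformly in x.
  have hCS : ∀ x ∈ D, (∫⁻ y in D, prodKernel (x - y) * h y) ^ 2 ≤
      K * ∫⁻ y in D, prodKernel (x - y) * h y ^ 2 := by
    intro x hx
    have hHol := ENNReal.lintegral_mul_le_Lp_mul_Lq (volume.restrict D) Real.HolderConjugate.two_two
      (f := fun y => prodKernel (x - y) ^ (1 / 2 : ℝ))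
      (g := fun y => prodKernel (x - y) ^ (1 / 2 : ℝ) * h y)
      ((hPx x).pow_const _).aemeasurable (((hPx x).pow_const _).aemeasurable.mul hh)
    have hsq : ∀ a : ℝ≥0∞, a ^ (1 / 2 : ℝ) * a ^ (1 / 2 : ℝ) = a := fun a => by
      rw [← ENNReal.rpow_add_of_nonneg _ _ (by norm_num) (by norm_num)]; norm_num
    have hsq2 : ∀ a : ℝ≥0∞, (a ^ (1 / 2 : ℝ)) ^ 2 = a := fun a => by rw [pow_two, hsq]
    simp only [Pi.mul_apply, ENNReal.rpow_two, mul_pow, hsq2, ← mul_assoc, hsq] at hHol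
    calc _ ≤ ((∫⁻ y in D, prodKernel (x - y)) ^ (1 / 2 : ℝ) *
          (∫⁻ y in D, prodKernel (x - y) * h y ^ 2) ^ (1 / 2 : ℝ)) ^ 2 := by gcongr
      _ = (∫⁻ y in D, prodKernel (x - y)) * ∫⁻ y in D, prodKernel (x - y) * h y ^ 2 := by
          rw [mul_pow, hsq2, hsq2]
      _ ≤ _ := by
          gcongr
          exact setLIntegral_prodKernel_le hD (hM x hx)
  calc _ ≤ ∫⁻ x in D, K * ∫⁻ y in D, prodKernel (x - y) * h y ^ 2 :=
        setLIntegral_mono' hD hCS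
    _ = K * ∫⁻ x in D, ∫⁻ y in D, prodKernel (x - y) * h y ^ 2 := by
        rw [lintegral_const_mul' _ _ (lintegral_cube_prodKernel_lt_top M).ne]
    _ = K * ∫⁻ y in D, ∫⁻ x in D, prodKernel (x - y) * h y ^ 2 := by
        rw [lintegral_lintegral_swap]
        exact ((measurable_prodKernel.comp (measurable_fst.sub measurable_snd)).aemeasurable).mul
          (hh.pow_const 2).comp_snd
    _ ≤ K * ∫⁻ y in D, K * h y ^ 2 := by
        gcongr K * ?_
        refine setLIntegral_mono' hD fun y hy => ?_
        have hm : Measurable fun x => prodKernel (x - y) :=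
          measurable_prodKernel.comp (measurable_id.sub measurable_const)
        rw [lintegral_mul_const _ hm]
        gcongr
        have hsymm : ∀ x, prodKernel (x - y) = prodKernel (y - x) := fun x => by
          simp only [prodKernel, PiLp.sub_apply, abs_sub_comm]
        simp only [hsymm]
        exact setLIntegral_prodKernel_le hD (hM y hy)
    _ = _ := by
        rw [lintegral_const_mul' _ _ (lintegral_cube_prodKernel_lt_top M).ne]; ring

/-! ### The layer estimate for Newtonian potentials -/

theorem continuous_hat : Continuous hat := by
  unfold hat
  fun_prop

theorem isOpen_cylinder {Ω : Set E2} (hΩ : IsOpen Ω) (L : ℝ) : IsOpen (cylinder Ω L) :=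
  (hΩ.preimage continuous_hat).inter
    (isOpen_Ioo.preimage (by fun_prop : Continuous fun x : E3 => x 2))

theorem isOpen_slab {Ω : Set E2} (hΩ : IsOpen Ω) (s : ℝ) (n : ℕ) : IsOpen (slab Ω s n) :=
  (hΩ.preimage continuous_hat).inter
    (isOpen_Ioo.preimage (by fun_prop : Continuous fun x : E3 => x 2))

theorem isBounded_cylinder {Ω : Set E2} (hΩ : Bornology.IsBounded Ω) (L : ℝ) :
    Bornology.IsBounded (cylinder Ω L) := by
  obtain ⟨r, hr⟩ := hΩ.exists_norm_le
  rw [isBounded_iff_forall_norm_le]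
  refine ⟨r + |L|, fun x hx => ?_⟩
  have h1 := hr _ hx.1
  have h2 : |x 2| ≤ |L| := by
    rw [abs_of_pos hx.2.1]
    exact hx.2.2.le.trans (le_abs_self L)
  have hr0 : 0 ≤ r := (norm_nonneg _).trans h1
  rw [EuclideanSpace.norm_eq, Fin.sum_univ_two] at h1
  rw [EuclideanSpace.norm_eq, Fin.sum_univ_three]
  rw [Real.sqrt_le_left hr0] at h1
  refine Real.sqrt_le_iff.2 ⟨by positivity, ?_⟩
  simp only [hat, Real.norm_eq_abs, sq_abs, PiLp.toLp_apply, Matrix.cons_val_zero,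
    Matrix.cons_val_one] at h1 ⊢
  have h3 : x 2 ^ 2 ≤ |L| ^ 2 := by
    rw [← sq_abs (x 2)]; exact pow_le_pow_left₀ (abs_nonneg _) h2 2
  nlinarith [mul_nonneg hr0 (abs_nonneg L)]

/-- The layers differ in whether the lower endpoint is included, but the slabs are open, so the
endpoints never matter. -/
theorem chi_eq_one {s : ℝ} {n : ℕ} {t : ℝ} (ht : t ∈ Ioo (n * s) ((n + 1) * s)) :
    chi s n t = 1 := by
  unfold chi
  split_ifs with h
  · subst h
    rw [indicator_of_mem (by simpa using ht)]; rfl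
  · rw [indicator_of_mem (show t ∈ Ico (n * s) ((n + 1) * s) from ⟨ht.1.le, ht.2⟩)]; rfl

theorem refField_point (x : E3) (t : ℝ) (i : Fin 2) :
    refField (point (hat x) t) i.castSucc = refField x i.castSucc := by
  fin_cases i <;> simp [refField, point, hat]

theorem dist_point_hat (x : E3) (t : ℝ) : dist (point (hat x) t) x = |x 2 - t| := by
  rw [EuclideanSpace.dist_eq, Fin.sum_univ_three]
  simp [point, hat, Real.sqrt_sq_eq_abs, Real.dist_eq, abs_sub_comm]

/-- On each slab the error is a potential increment between two points at distance at most s,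
because `refField` cancels. The kernel bound gives s times one operator independent of the layer;
the slabs are disjoint in D, so a single application of the Schur test covers the sum. -/
theorem layerError_le {Ω : Set E2} (hΩ : IsOpen Ω) (hΩb : Bornology.IsBounded Ω) {L : ℝ}
    (hL : 0 < L) {M : ℝ} (hM : ∀ x ∈ cylinder Ω L, ∀ y ∈ cylinder Ω L, x - y ∈ cube M)
    {h₀ : ℝ} {g : E3 → ℝ} (hg : MemLp g 2 (volume.restrict (cylinder Ω L))) {i : Fin 2}
    {u : E3 → ℝ}
    (hu : ∀ x, u x - h₀ * refField x i.castSucc = newtonPotential (cylinder Ω L) g x)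
    {N : ℕ} (hN : 0 < N) :
    layerError Ω L N u ≤ ENNReal.ofReal (L / N) ^ 2 * ((∫⁻ z in cube M, prodKernel z) ^ 2 *
      eLpNorm g 2 (volume.restrict (cylinder Ω L)) ^ 2) := by
  set D := cylinder Ω L
  set s := L / N with hs_def
  have hN' : (0 : ℝ) < N := by exact_mod_cast hN
  have hs : 0 < s := by positivity
  have hDm : MeasurableSet D := (isOpen_cylinder hΩ L).measurableSet
  have hDb : Bornology.IsBounded D := isBounded_cylinder hΩb L
  set W : E3 → ℝ≥0∞ := fun x => ∫⁻ y in D, prodKernel (x - y) * ‖g y‖ₑ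
  have hpt : ∀ n : ℕ, ∀ x ∈ slab Ω s n,
      ‖u (point (hat x) (n * s)) * chi s n (x 2) - u x‖ₑ ^ 2 ≤
        (ENNReal.ofReal s * W x) ^ 2 := by
    intro n x hx
    set x' := point (hat x) (n * s)
    have hd : dist x' x ≤ s := by
      rw [dist_point_hat, abs_of_pos (by linarith [hx.2.1])]
      nlinarith [hx.2.2]
    gcongr
    have e1 : u x' * chi s n (x 2) - u x = newtonPotential D g x' - newtonPotential D g x := by
      rw [chi_eq_one hx.2, ← hu, ← hu, refField_point]; ring
    have e2 : newtonPotential D g x' - newtonPotential D g x =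
        ∫ y in D, (newtonKernel x' y - newtonKernel x y) * g y := by
      simp only [sub_mul]
      exact (integral_sub (integrableOn_newtonKernel_mul hDm hDb hg x')
        (integrableOn_newtonKernel_mul hDm hDb hg x)).symm
    rw [e1, e2]
    refine (enorm_integral_le_lintegral_enorm _).trans ?_
    rw [← lintegral_const_mul' _ _ ENNReal.ofReal_ne_top]
    refine lintegral_mono fun y => ?_
    rw [enorm_mul, ← mul_assoc]
    gcongr
    rw [Real.enorm_eq_ofReal_abs]
    exact abs_newtonKernel_sub_le (by simp [x', point, hat]) (by simp [x', point, hat]) hs hd y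
  have hsub : ⋃ n ∈ Finset.range N, slab Ω s n ⊆ D := by
    refine iUnion₂_subset fun n hn x hx => ⟨hx.1, ?_, ?_⟩
    · have := hx.2.1
      have h0 : 0 ≤ (n : ℝ) * s := by positivity
      linarith
    · have h1 : ((n : ℝ) + 1) ≤ N := by exact_mod_cast Finset.mem_range.1 hn
      have h2 : (N : ℝ) * s = L := by rw [hs_def]; field_simp
      have := hx.2.2
      nlinarith
  have hdisj : Set.PairwiseDisjoint (↑(Finset.range N)) (slab Ω s) := by
    have key : ∀ m n : ℕ, m < n → ∀ x, x ∈ slab Ω s m → x ∉ slab Ω s n := by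
      intro m n hmn x hm hn
      have h1 : ((m : ℝ) + 1) ≤ n := by exact_mod_cast hmn
      have := hm.2.2
      have := hn.2.1
      nlinarith
    intro m _ n _ hmn
    refine Set.disjoint_left.2 fun x hm hn => ?_
    rcases lt_or_gt_of_ne hmn with h | h
    · exact key m n h x hm hn
    · exact key n m h x hn hm
  calc layerError Ω L N u
      ≤ ∑ n ∈ Finset.range N, ∫⁻ x in slab Ω s n, (ENNReal.ofReal s * W x) ^ 2 := by
        refine Finset.sum_le_sum fun n _ => ?_
        rw [eLpNorm_two_sq_eq]
        exact setLIntegral_mono' (isOpen_slab hΩ s n).measurableSet (hpt n)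
    _ = ∫⁻ x in ⋃ n ∈ Finset.range N, slab Ω s n, (ENNReal.ofReal s * W x) ^ 2 :=
        (lintegral_biUnion_finset hdisj (fun n _ => (isOpen_slab hΩ s n).measurableSet) _).symm
    _ ≤ ∫⁻ x in D, (ENNReal.ofReal s * W x) ^ 2 := lintegral_mono_set hsub
    _ = ENNReal.ofReal s ^ 2 * ∫⁻ x in D, W x ^ 2 := by
        simp only [mul_pow]
        rw [lintegral_const_mul' _ _ (by simp)]
    _ ≤ _ := by
        gcongr
        rw [eLpNorm_two_sq_eq]
        exact schur_prodKernel hDm hM hg.1.enorm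

theorem exists_layerError_bound {Ω : Set E2} (hΩ : IsOpen Ω) (hΩb : Bornology.IsBounded Ω) {L : ℝ}
    (hL : 0 < L) :
    ∃ C : ℝ, 0 < C ∧
      ∀ (h₀ : ℝ) (g : E3 → ℝ), MemLp g 2 (volume.restrict (cylinder Ω L)) →
        ∀ (i : Fin 2) (u : E3 → ℝ),
          (∀ x, u x - h₀ * refField x i.castSucc = newtonPotential (cylinder Ω L) g x) →
          (∀ α : ℝ, 1 / 2 < α → α < 1 → ∀ N : ℕ, 0 < N →
            layerError Ω L N u ≤ ENNReal.ofReal (C * (L / N) ^ (4 * α - 2)) *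
              eLpNorm g 2 (volume.restrict (cylinder Ω L)) ^ 2) ∧
          Tendsto (fun N : ℕ => layerError Ω L N u) atTop (𝓝 0) := by
  obtain ⟨M, hM⟩ := exists_sub_mem_cube (isBounded_cylinder hΩb L)
  obtain ⟨k, hk0, hk⟩ : ∃ k : ℝ, 0 ≤ k ∧ ∫⁻ z in cube M, prodKernel z = ENNReal.ofReal k :=
    ⟨_, ENNReal.toReal_nonneg,
      (ENNReal.ofReal_toReal (lintegral_cube_prodKernel_lt_top M).ne).symm⟩
  set m := max 1 L
  have hm1 : 1 ≤ m := le_max_left _ _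
  -- The surplus factor (L/N)^(4-4α) has exponent between 0 and 2 and base at most m, hence is at
  -- most m², uniformly in α. The summand 1 only keeps the constant positive.
  refine ⟨m ^ 2 * (k ^ 2 + 1), by positivity, fun h₀ g hg i u hu => ?_⟩
  have hbound : ∀ α : ℝ, 1 / 2 < α → α < 1 → ∀ N : ℕ, 0 < N →
      layerError Ω L N u ≤ ENNReal.ofReal (m ^ 2 * (k ^ 2 + 1) * (L / N) ^ (4 * α - 2)) *
        eLpNorm g 2 (volume.restrict (cylinder Ω L)) ^ 2 := by
    intro α hα1 hα2 N hN
    refine (layerError_le hΩ hΩb hL hM hg hu hN).trans ?_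
    rw [← mul_assoc]
    gcongr
    have hN' : (1 : ℝ) ≤ N := by exact_mod_cast hN
    have hs : 0 < L / N := by positivity
    have hsm : L / N ≤ m := (div_le_self hL.le hN').trans (le_max_right _ _)
    rw [hk, ← ENNReal.ofReal_pow hs.le, ← ENNReal.ofReal_pow hk0, ← ENNReal.ofReal_mul (by positivity)]
    refine ENNReal.ofReal_le_ofReal ?_
    have e : (L / N) ^ 2 = (L / N) ^ (4 * α - 2) * (L / N) ^ (4 - 4 * α) := by
      rw [← Real.rpow_add hs, ← Real.rpow_natCast]; norm_num
    have h1 : (L / N) ^ (4 - 4 * α) ≤ m ^ 2 := by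
      calc (L / N) ^ (4 - 4 * α) ≤ m ^ (4 - 4 * α) :=
            Real.rpow_le_rpow hs.le hsm (by linarith)
        _ ≤ m ^ (2 : ℝ) := Real.rpow_le_rpow_of_exponent_le hm1 (by linarith)
        _ = m ^ 2 := Real.rpow_two m
    rw [e]
    have hp : 0 ≤ (L / N) ^ (4 * α - 2) := by positivity
    calc (L / N) ^ (4 * α - 2) * (L / N) ^ (4 - 4 * α) * k ^ 2
        ≤ (L / N) ^ (4 * α - 2) * m ^ 2 * (k ^ 2 + 1) := by gcongr; linarith
      _ = _ := by ring
  refine ⟨hbound, ?_⟩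
  -- The choice α = 3/4 makes the exponent 4α - 2 equal to 1.
  have hlim : Tendsto (fun N : ℕ => ENNReal.ofReal (m ^ 2 * (k ^ 2 + 1) *
      (L / N) ^ (4 * (3 / 4 : ℝ) - 2)) * eLpNorm g 2 (volume.restrict (cylinder Ω L)) ^ 2)
      atTop (𝓝 0) := by
    have h1 : Tendsto (fun N : ℕ => m ^ 2 * (k ^ 2 + 1) *
        (L / N) ^ (4 * (3 / 4 : ℝ) - 2)) atTop (𝓝 0) := by
      have : Tendsto (fun N : ℕ => L / (N : ℝ)) atTop (𝓝 0) := tendsto_const_div_atTop_nhds_zero_nat L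
      have e : (4 * (3 / 4 : ℝ) - 2) = 1 := by norm_num
      simpa [e] using this.const_mul (m ^ 2 * (k ^ 2 + 1))
    have h2 := ENNReal.Tendsto.mul_const (b := eLpNorm g 2 (volume.restrict (cylinder Ω L)) ^ 2)
      (ENNReal.tendsto_ofReal h1) (Or.inr (ENNReal.pow_ne_top hg.2.ne))
    simpa using h2
  refine tendsto_of_tendsto_of_tendsto_of_le_of_le' tendsto_const_nhds hlim
    (Eventually.of_forall fun _ => zero_le) ?_
  filter_upwards [eventually_gt_atTop 0] with N hN
  exact hbound (3 / 4) (by norm_num) (by norm_num) N hN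

/-! ### Quadratic expansions in `L²` -/

section Quadratic

variable {α F : Type*} [MeasurableSpace α] {μ : Measure α} [NormedAddCommGroup F]
  [InnerProductSpace ℝ F]

theorem integrable_inner_of_memLp_two {f h : α → F} (hf : MemLp f 2 μ) (hh : MemLp h 2 μ) :
    Integrable (fun x => inner ℝ (f x) (h x)) μ :=
  (hf.norm.integrable_mul hh.norm).mono' (hf.1.inner hh.1)
    (Eventually.of_forall fun _ => norm_inner_le_norm _ _)

theorem integral_norm_add_smul_sq {f h : α → F} (hf : MemLp f 2 μ) (hh : MemLp h 2 μ) (t : ℝ) :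
    ∫ x, ‖f x + t • h x‖ ^ 2 ∂μ =
      (∫ x, ‖f x‖ ^ 2 ∂μ) + t * (2 * ∫ x, inner ℝ (f x) (h x) ∂μ) +
        t ^ 2 * ∫ x, ‖h x‖ ^ 2 ∂μ := by
  have i1 := (memLp_two_iff_integrable_sq_norm hf.1).1 hf
  have i2 : Integrable (fun x => t * (2 * inner ℝ (f x) (h x))) μ :=
    ((integrable_inner_of_memLp_two hf hh).const_mul 2).const_mul t
  have i3 : Integrable (fun x => t ^ 2 * ‖h x‖ ^ 2) μ :=
    ((memLp_two_iff_integrable_sq_norm hh.1).1 hh).const_mul _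
  have i12 : Integrable (fun x => ‖f x‖ ^ 2 + t * (2 * inner ℝ (f x) (h x))) μ := i1.add i2
  have e : ∀ x, ‖f x + t • h x‖ ^ 2 =
      ‖f x‖ ^ 2 + t * (2 * inner ℝ (f x) (h x)) + t ^ 2 * ‖h x‖ ^ 2 := fun x => by
    rw [norm_add_sq_real, inner_smul_right, norm_smul, mul_pow, Real.norm_eq_abs, sq_abs]; ring
  simp only [e]
  rw [integral_add i12 i3, integral_add i1 i2, integral_const_mul, integral_const_mul,
    integral_const_mul]

end Quadratic

theorem eLpNorm_two_sq_eq_ofReal {α F : Type*} [MeasurableSpace α] {μ : Measure α}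
    [NormedAddCommGroup F] {f : α → F} (hf : MemLp f 2 μ) :
    eLpNorm f 2 μ ^ 2 = ENNReal.ofReal (∫ x, ‖f x‖ ^ 2 ∂μ) := by
  have hf2 := (memLp_two_iff_integrable_sq_norm hf.1).1 hf
  have e : ∀ x, ‖f x‖ₑ ^ 2 = ENNReal.ofReal (‖f x‖ ^ 2) := fun x => by
    rw [ENNReal.ofReal_pow (norm_nonneg _), ofReal_norm]
  rw [eLpNorm_two_sq_eq]
  simp only [e]
  exact (ofReal_integral_eq_lintegral_ofReal hf2 (Eventually.of_forall fun x => by positivity)).symm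

theorem eq_zero_of_quadratic_nonneg {p q : ℝ} (h : ∀ t : ℝ, 0 ≤ t * p + t ^ 2 * q) : p = 0 := by
  have := discrim_le_zero (a := q) (b := p) (c := 0) fun t => by
    have := h t
    nlinarith
  rw [discrim] at this
  nlinarith

/-! ### Test vector fields -/

/-- The vector field with the given components. -/
def toVec (X : Fin 3 → TestFn) (x : E3) : E3 := WithLp.toLp 2 fun i => X i x

@[simp] theorem toVec_apply (X : Fin 3 → TestFn) (x : E3) (i : Fin 3) : toVec X x i = X i x := rfl

theorem isTest_toVec (X : Fin 3 → TestFn) : IsTest (toVec X) := by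
  refine ⟨contDiff_euclidean.2 fun i => (X i).contDiff, ?_⟩
  choose ρ _ hρ using fun i => (X i).exists_radius
  refine HasCompactSupport.intro (isCompact_closedBall (0 : E3) (∑ i, |ρ i|)) fun x hx => ?_
  rw [mem_closedBall_zero_iff, not_le] at hx
  ext i
  refine hρ i x (lt_of_le_of_lt ((le_abs_self _).trans ?_) hx)
  exact Finset.single_le_sum (f := fun i => |ρ i|) (fun i _ => abs_nonneg _) (Finset.mem_univ i)

theorem memLp_toVec (X : Fin 3 → TestFn) (p : ℝ≥0∞) : MemLp (toVec X) p :=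
  (isTest_toVec X).1.continuous.memLp_of_hasCompactSupport (isTest_toVec X).2

theorem locallyIntegrable_toVec (X : Fin 3 → TestFn) : LocallyIntegrable (toVec X) :=
  (isTest_toVec X).1.continuous.locallyIntegrable

theorem locallyIntegrable_coord {A : E3 → E3} (hA : LocallyIntegrable A) (i : Fin 3) :
    LocallyIntegrable fun x => A x i := fun x => by
  obtain ⟨U, hU, hi⟩ := hA x
  exact ⟨U, hU, (EuclideanSpace.proj (𝕜 := ℝ) i : E3 →L[ℝ] ℝ).integrable_comp hi⟩

theorem partialD_eq_dd {φ : E3 → ℝ} (hφ : IsTest φ) (j : Fin 3) :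
    partialD j φ = dd j ⟨φ, hφ⟩ := rfl

theorem integral_test_mul_dd (X φ : TestFn) (j : Fin 3) :
    ∫ x, X x * dd j φ x = -∫ x, dd j X x * φ x :=
  integral_mul_dd (X.contDiff.of_le (by simp)) j φ

theorem TestFn.integrable_mul_test (X φ : TestFn) : Integrable fun x => X x * φ x :=
  φ.integrable_mul X.continuous.locallyIntegrable

theorem HasWeakPartial.add_test {j : Fin 3} {f f' : E3 → ℝ} (h : HasWeakPartial j f f')
    (X : TestFn) : HasWeakPartial j (fun x => f x + X x) (fun x => f' x + dd j X x) := by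
  obtain ⟨hf, hf', hw⟩ := h
  refine ⟨hf.add X.continuous.locallyIntegrable, hf'.add (dd j X).continuous.locallyIntegrable,
    fun φ hφ => ?_⟩
  have e := hw φ hφ
  rw [partialD_eq_dd hφ] at e ⊢
  set ψ : TestFn := ⟨φ, hφ⟩
  change _ = -∫ x, f' x * ψ x at e
  change _ = -∫ x, (f' x + dd j X x) * ψ x
  simp only [add_mul]
  rw [integral_add ((dd j ψ).integrable_mul hf) (X.integrable_mul_test _),
    integral_add (ψ.integrable_mul hf') ((dd j X).integrable_mul_test _), e,
    integral_test_mul_dd]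
  ring

theorem MemL2loc.add {F : Type*} [NormedAddCommGroup F] {f g : E3 → F} (hf : MemL2loc f)
    (hg : MemL2loc g) : MemL2loc fun x => f x + g x := fun K hK => (hf K hK).add (hg K hK)

theorem MemH1loc.add_test {A : E3 → E3} (h : MemH1loc A) (X : Fin 3 → TestFn) :
    MemH1loc fun x => A x + toVec X x := by
  refine ⟨h.1.add fun K _ => (memLp_toVec X 2).restrict K, fun i j => ?_⟩
  obtain ⟨f', hf', hw⟩ := h.2 i j
  exact ⟨_, hf'.add fun K _ => ((dd j (X i)).memLp 2).restrict K, hw.add_test (X i)⟩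

theorem HasWeakCurl.add_test {A w : E3 → E3} (h : HasWeakCurl A w) (X : Fin 3 → TestFn) :
    HasWeakCurl (fun x => A x + toVec X x) (fun x => w x + toVec (curlT X) x) := by
  obtain ⟨hA, hw, hc⟩ := h
  refine ⟨hA.add (locallyIntegrable_toVec X), hw.add (locallyIntegrable_toVec _),
    fun k φ hφ => ?_⟩
  have e := hc k φ hφ
  rw [partialD_eq_dd hφ, partialD_eq_dd hφ] at e ⊢
  set ψ : TestFn := ⟨φ, hφ⟩
  change ∫ x, w x k * ψ x = _ at e
  change ∫ x, (w x + toVec (curlT X) x) k * ψ x = _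
  have i1 := ψ.integrable_mul (locallyIntegrable_coord hw (k))
  have i2 := (curlT X k).integrable_mul_test ψ
  have i3 := (dd (k + 2) ψ).integrable_mul (locallyIntegrable_coord hA (k + 1))
  have i4 := (dd (k + 1) ψ).integrable_mul (locallyIntegrable_coord hA (k + 2))
  have i5 := (X (k + 1)).integrable_mul_test (dd (k + 2) ψ)
  have i6 := (X (k + 2)).integrable_mul_test (dd (k + 1) ψ)
  have i7 := (dd (k + 1) (X (k + 2))).integrable_mul_test ψ
  have i8 := (dd (k + 2) (X (k + 1))).integrable_mul_test ψ
  have e1 : ∫ x, (w x + toVec (curlT X) x) k * ψ x =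
      (∫ x, w x k * ψ x) + ∫ x, curlT X k x * ψ x := by
    rw [← integral_add i1 i2]
    simp only [PiLp.add_apply, toVec_apply, add_mul]
  have e2 : ∫ x, curlT X k x * ψ x =
      (∫ x, dd (k + 1) (X (k + 2)) x * ψ x) - ∫ x, dd (k + 2) (X (k + 1)) x * ψ x := by
    rw [← integral_sub i7 i8]
    simp only [curlT, TestFn.sub_apply, sub_mul]
  have e3 : (∫ x, ((A x + toVec X x) (k + 1) * dd (k + 2) ψ x -
      (A x + toVec X x) (k + 2) * dd (k + 1) ψ x)) =
      (∫ x, (A x (k + 1) * dd (k + 2) ψ x - A x (k + 2) * dd (k + 1) ψ x)) +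
      ((∫ x, X (k + 1) x * dd (k + 2) ψ x) - ∫ x, X (k + 2) x * dd (k + 1) ψ x) := by
    have i34 : Integrable fun x => A x (k + 1) * dd (k + 2) ψ x - A x (k + 2) * dd (k + 1) ψ x :=
      i3.sub i4
    have i56 : Integrable fun x => X (k + 1) x * dd (k + 2) ψ x - X (k + 2) x * dd (k + 1) ψ x :=
      i5.sub i6
    rw [← integral_sub i5 i6, ← integral_add i34 i56]
    refine integral_congr_ae (Eventually.of_forall fun x => ?_)
    simp only [PiLp.add_apply, toVec_apply]
    ring
  rw [e1, e2, e3, e, integral_test_mul_dd, integral_test_mul_dd]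
  ring

theorem WeakDivFree.add_test {A : E3 → E3} (hA : LocallyIntegrable A) (h : WeakDivFree A)
    {X : Fin 3 → TestFn} (hX : divT X = 0) : WeakDivFree fun x => A x + toVec X x := by
  intro φ hφ
  have e := h φ hφ
  simp only [partialD_eq_dd hφ] at e ⊢
  set ψ : TestFn := ⟨φ, hφ⟩
  have hXi : ∫ x, ∑ i, X i x * dd i ψ x = 0 := by
    rw [integral_finsetSum _ fun i _ => (X i).integrable_mul_test _]
    simp only [integral_test_mul_dd]
    rw [Finset.sum_neg_distrib, ← integral_finsetSum _ fun i _ => (dd i (X i)).integrable_mul_test _,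
      neg_eq_zero]
    refine integral_eq_zero_of_ae (Eventually.of_forall fun x => ?_)
    have hx : ∑ i, dd i (X i) x = divT X x := by simp [divT, Fin.sum_univ_three]
    simp only [← Finset.sum_mul, hx, hX, TestFn.zero_apply, zero_mul, Pi.zero_apply]
  simp only [PiLp.add_apply, toVec_apply, add_mul, Finset.sum_add_distrib]
  rw [integral_add (integrable_finsetSum _ fun i _ => (dd i ψ).integrable_mul (locallyIntegrable_coord hA i))
    (integrable_finsetSum _ fun i _ => (X i).integrable_mul_test _), e, hXi, add_zero]

theorem MemHCheck.add_test {A : E3 → E3} (h : MemHCheck A) (X : Fin 3 → TestFn) :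
    MemHCheck fun x => A x + toVec X x := by
  obtain ⟨hA, Φ, G, hΦ, hG, hlim, hlim'⟩ := h
  have hX := isTest_toVec X
  refine ⟨hA.add (memLp_toVec X 6), fun m x => Φ m x + toVec X x,
    fun j x => G j x + partialD j (toVec X) x, fun m => ⟨(hΦ m).1.add hX.1, (hΦ m).2.add hX.2⟩,
    fun j => (hG j).add ?_, ?_, fun j => ?_⟩
  · refine Continuous.memLp_of_hasCompactSupport ?_ (hX.2.fderiv_apply (𝕜 := ℝ) _)
    exact (hX.1.continuous_fderiv (by simp)).clm_apply continuous_const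
  · simpa only [add_sub_add_right_eq_sub] using hlim
  · have e : ∀ m, partialD j (fun x => Φ m x + toVec X x) =
        fun x => partialD j (Φ m) x + partialD j (toVec X) x := fun m => by
      ext1 x
      exact congrArg (fun l : E3 →L[ℝ] E3 => l (EuclideanSpace.single j (1 : ℝ)))
        (fderiv_add ((hΦ m).1.differentiable (by simp) x) (hX.1.differentiable (by simp) x))
    simpa only [e, add_sub_add_right_eq_sub] using hlim' j

/-- Compactly supported solenoidal fields are admissible variations of the potential; the first
variation needs no others. -/
theorem MemK0.add_test {h₀ : ℝ} {A : E3 → E3} (h : MemK0 h₀ A) {X : Fin 3 → TestFn}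
    (hX : divT X = 0) : MemK0 h₀ fun x => A x + toVec X x := by
  obtain ⟨⟨h1, w, hw, hwL⟩, hd, hc⟩ := h
  refine ⟨⟨h1.add_test X, _, hw.add_test X, ?_⟩, hd.add_test hw.1 hX, ?_⟩
  · convert hwL.add (memLp_toVec (curlT X) 2) using 1
    ext1 x
    simp only [Pi.add_apply]; abel
  · convert hc.add_test X using 1
    ext1 x
    exact add_sub_right_comm _ _ _

theorem HasWeakCurl.ae_eq {A w w' : E3 → E3} (h : HasWeakCurl A w) (h' : HasWeakCurl A w') :
    ∀ᵐ x, w x = w' x := by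
  have hk : ∀ k : Fin 3, ∀ᵐ x, w x k = w' x k := fun k =>
    ae_eq_of_integral_contDiff_smul_eq (locallyIntegrable_coord h.2.1 (k)) (locallyIntegrable_coord h'.2.1 (k)) fun φ hφ hφc => by
      have := (h.2.2 k φ ⟨hφ, hφc⟩).trans (h'.2.2 k φ ⟨hφ, hφc⟩).symm
      simpa only [smul_eq_mul, mul_comm] using this
  filter_upwards [ae_all_iff.2 hk] with x hx
  ext k; exact hx k

/-- All weak curls of A agree almost everywhere, so the infimum is over equal values. -/
theorem magneticEnergy_eq {h₀ : ℝ} {A w : E3 → E3} (h : HasWeakCurl A w) :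
    magneticEnergy h₀ A = eLpNorm (fun x => w x - appliedField h₀) 2 volume ^ 2 := by
  refine le_antisymm (iInf₂_le w h) (le_iInf₂ fun w' h' => le_of_eq ?_)
  congr 1
  refine eLpNorm_congr_ae ?_
  filter_upwards [h.ae_eq h'] with x hx
  rw [hx]

/-! ### Horizontal gradients and the curl term -/

/-- The horizontal gradient of a test function. -/
def gradHat (φ : TestFn) (x : E3) : E2 := !₂[dd 0 φ x, dd 1 φ x]

theorem memLp_gradHat (φ : TestFn) (p : ℝ≥0∞) : MemLp (gradHat φ) p := by
  have h0 := (dd 0 φ).continuous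
  have h1 := (dd 1 φ).continuous
  obtain ⟨ρ, _, hρ⟩ := (dd 0 φ).exists_radius
  obtain ⟨ρ', _, hρ'⟩ := (dd 1 φ).exists_radius
  refine Continuous.memLp_of_hasCompactSupport (by unfold gradHat; fun_prop) ?_
  refine HasCompactSupport.intro (isCompact_closedBall (0 : E3) (max ρ ρ')) fun x hx => ?_
  rw [mem_closedBall_zero_iff, not_le] at hx
  ext i
  fin_cases i
  · exact hρ x ((le_max_left _ _).trans_lt hx)
  · exact hρ' x ((le_max_right _ _).trans_lt hx)

theorem memLp_coord {n : ℕ} {v : E3 → EuclideanSpace ℝ (Fin n)} {p : ℝ≥0∞} {μ : Measure E3}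
    (hv : MemLp v p μ) (i : Fin n) : MemLp (fun x => v x i) p μ :=
  (EuclideanSpace.proj (𝕜 := ℝ) i : EuclideanSpace ℝ (Fin n) →L[ℝ] ℝ).comp_memLp' hv

/-- Horizontal gradients do not contribute to the distributional curl. -/
theorem IsCurlMeasure.add_gradHat {D : Set E3} {v : E3 → E2}
    (hv : MemLp v 2 (volume.restrict D)) {μ : SignedMeasure D} (h : IsCurlMeasure D v μ)
    (φ : TestFn) : IsCurlMeasure D (fun x => v x + gradHat φ x) μ := by
  intro ψ hψ hsupp
  rw [h ψ hψ hsupp]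
  simp only [partialD_eq_dd hψ]
  set η : TestFn := ⟨ψ, hψ⟩
  -- The derivatives of η vanish off D, so the integral extends to the whole space, where
  -- integration by parts leaves the difference of two equal mixed derivatives.
  have hzero : ∫ x in D, (dd 0 φ x * dd 1 η x - dd 1 φ x * dd 0 η x) = 0 := by
    rw [setIntegral_eq_integral_of_forall_compl_eq_zero]
    · rw [integral_sub ((dd 0 φ).integrable_mul_test _) ((dd 1 φ).integrable_mul_test _),
        integral_test_mul_dd, integral_test_mul_dd, dd_comm]
      ring
    · intro x hx
      have hz : ∀ j, dd j η x = 0 := fun j => by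
        have : fderiv ℝ ψ x = 0 := by
          by_contra hne
          exact hx (hsupp (support_fderiv_subset ℝ hne))
        change fderiv ℝ ψ x _ = 0
        rw [this]; rfl
      rw [hz, hz]; ring
  have i0 : Integrable (fun x => v x 0 * dd 1 η x) (volume.restrict D) :=
    (memLp_coord hv 0).integrable_mul (((dd 1 η).memLp 2).restrict D)
  have i1 : Integrable (fun x => v x 1 * dd 0 η x) (volume.restrict D) :=
    (memLp_coord hv 1).integrable_mul (((dd 0 η).memLp 2).restrict D)
  have i2 := ((dd 0 φ).integrable_mul_test (dd 1 η)).restrict (s := D)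
  have i3 := ((dd 1 φ).integrable_mul_test (dd 0 η)).restrict (s := D)
  have i01 : Integrable (fun x => v x 0 * dd 1 η x - v x 1 * dd 0 η x) (volume.restrict D) :=
    i0.sub i1
  have i23 : Integrable (fun x => dd 0 φ x * dd 1 η x - dd 1 φ x * dd 0 η x)
    (volume.restrict D) := i2.sub i3
  have key : ∫ x in D, ((v x + gradHat φ x) 0 * dd 1 η x - (v x + gradHat φ x) 1 * dd 0 η x) =
      (∫ x in D, (v x 0 * dd 1 η x - v x 1 * dd 0 η x)) +
        ∫ x in D, (dd 0 φ x * dd 1 η x - dd 1 φ x * dd 0 η x) := by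
    rw [← integral_add i01 i23]
    refine integral_congr_ae (Eventually.of_forall fun x => ?_)
    simp only [gradHat, PiLp.add_apply, Matrix.cons_val_zero, Matrix.cons_val_one]
    ring
  rw [key, hzero, add_zero]

theorem MemV.add_gradHat {D : Set E3} {v : E3 → E2} (h : MemV D v) (φ : TestFn) :
    MemV D fun x => v x + gradHat φ x := by
  obtain ⟨hv, μ, hμ⟩ := h
  exact ⟨hv.add ((memLp_gradHat φ 2).restrict D), μ, hμ.add_gradHat hv φ⟩

/-- Every curl measure of v is one of the perturbed field. This inequality alone suffices, since the
perturbed field is the competitor in the minimality condition. -/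
theorem curlVariation_add_gradHat_le {D : Set E3} {v : E3 → E2}
    (hv : MemLp v 2 (volume.restrict D)) (φ : TestFn) :
    curlVariation D (fun x => v x + gradHat φ x) ≤ curlVariation D v :=
  le_iInf₂ fun μ hμ => iInf₂_le μ (hμ.add_gradHat hv φ)

theorem curlVariation_ne_top {D : Set E3} {v : E3 → E2} (h : MemV D v) :
    curlVariation D v ≠ ⊤ := by
  obtain ⟨-, μ, hμ⟩ := h
  exact ((iInf₂_le μ hμ).trans_lt (measure_lt_top _ _)).ne

theorem memLp_hat {A : E3 → E3} {p : ℝ≥0∞} {μ : Measure E3} (h : MemLp A p μ) :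
    MemLp (fun x => hat (A x)) p μ := by
  let l : E3 →L[ℝ] E2 := LinearMap.toContinuousLinearMap
    { toFun := hat
      map_add' := fun x y => by ext i; fin_cases i <;> simp [hat]
      map_smul' := fun c x => by ext i; fin_cases i <;> simp [hat] }
  exact l.comp_memLp' h

theorem MemL2loc.memLp_restrict {F : Type*} [NormedAddCommGroup F] {f : E3 → F} (hf : MemL2loc f)
    {D : Set E3} (hD : Bornology.IsBounded D) : MemLp f 2 (volume.restrict D) :=
  (hf _ hD.isCompact_closure).mono_measure (Measure.restrict_mono subset_closure le_rfl)

/-! ### The Euler–Lagrange equation -/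

/-- The Euler–Lagrange equation of the limiting energy, for horizontal gradients and compactly
supported solenoidal fields. -/
theorem euler_lagrange {D : Set E3} (hD : Bornology.IsBounded D) {h₀ : ℝ} {v : E3 → E2}
    {A w : E3 → E3} (hmin : IsMinimizer D h₀ v A) (hw : HasWeakCurl A w)
    (hwL : MemLp (fun x => w x - appliedField h₀) 2) (φ : TestFn) {X : Fin 3 → TestFn}
    (hX : divT X = 0) :
    (∫ x in D, inner ℝ (v x - hat (A x)) (gradHat φ x - hat (toVec X x))) +
      ∫ x, inner ℝ (w x - appliedField h₀) (toVec (curlT X) x) = 0 := by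
  obtain ⟨hV, hK, hle⟩ := hmin
  have hg : MemLp (fun x => v x - hat (A x)) 2 (volume.restrict D) :=
    hV.1.sub (memLp_hat (hK.1.1.1.memLp_restrict hD))
  have hb : MemLp (fun x => gradHat φ x - hat (toVec X x)) 2 (volume.restrict D) :=
    ((memLp_gradHat φ 2).sub (memLp_hat (memLp_toVec X 2))).restrict D
  have hc := memLp_toVec (curlT X) 2
  have hquad : ∀ t : ℝ, 0 ≤ t * (2 * (∫ x in D, inner ℝ (v x - hat (A x))
        (gradHat φ x - hat (toVec X x))) + 2 * ∫ x, inner ℝ (w x - appliedField h₀)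
        (toVec (curlT X) x)) +
      t ^ 2 * ((∫ x in D, ‖gradHat φ x - hat (toVec X x)‖ ^ 2) +
        ∫ x, ‖toVec (curlT X) x‖ ^ 2) := by
    intro t
    have htX : divT (t • X) = 0 := by
      have : divT (t • X) = t • divT X := by simp [divT, Finset.smul_sum]
      rw [this, hX, smul_zero]
    have htc : curlT (t • X) = t • curlT X := by
      ext k x
      simp [curlT, smul_sub]
    have htv : ∀ Y : Fin 3 → TestFn, ∀ x, toVec (t • Y) x = t • toVec Y x := fun Y x => by
      ext k; simp [toVec]
    have hgr : ∀ x, gradHat (t • φ) x = t • gradHat φ x := fun x => by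
      ext k; fin_cases k <;> simp [gradHat]
    have h := hle _ _ (hV.add_gradHat (t • φ)) (hK.add_test htX)
    have hwt := hw.add_test (t • X)
    rw [limitEnergy, limitEnergy, magneticEnergy_eq hw, magneticEnergy_eq hwt] at h
    have e1 : ∀ x, v x + gradHat (t • φ) x - hat (A x + toVec (t • X) x) =
        (v x - hat (A x)) + t • (gradHat φ x - hat (toVec X x)) := fun x => by
      rw [hgr, htv]
      ext i; fin_cases i <;> simp [hat] <;> ring
    have e2 : ∀ x, w x + toVec (curlT (t • X)) x - appliedField h₀ =
        (w x - appliedField h₀) + t • toVec (curlT X) x := fun x => by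
      rw [htc, htv]; abel
    simp only [e1, e2] at h
    have hgt : MemLp (fun x => (v x - hat (A x)) + t • (gradHat φ x - hat (toVec X x))) 2
        (volume.restrict D) := hg.add (hb.const_smul t)
    have hwt' : MemLp (fun x => (w x - appliedField h₀) + t • toVec (curlT X) x) 2 :=
      hwL.add (hc.const_smul t)
    rw [eLpNorm_two_sq_eq_ofReal hg, eLpNorm_two_sq_eq_ofReal hwL, eLpNorm_two_sq_eq_ofReal hgt,
      eLpNorm_two_sq_eq_ofReal hwt', ENNReal.div_le_iff (by norm_num) (by norm_num),
      ENNReal.div_mul_cancel (by norm_num) (by norm_num)] at h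
    -- The variation term of the competitor is replaced by that of v and then cancelled, which
    -- requires its finiteness. What remains is a quadratic inequality in t.
    have hmono := curlVariation_add_gradHat_le hV.1 (t • φ)
    set c := curlVariation D v
    have hcv : c ≠ ⊤ := curlVariation_ne_top hV
    have h3 := h.trans (add_le_add_left (add_le_add_right hmono _) _)
    rw [add_right_comm, add_right_comm (ENNReal.ofReal _) c] at h3
    have h4 := (ENNReal.add_le_add_iff_right hcv).1 h3
    rw [← ENNReal.ofReal_add (integral_nonneg fun x => by positivity)
        (integral_nonneg fun x => by positivity),
      ← ENNReal.ofReal_add (integral_nonneg fun x => by positivity)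
        (integral_nonneg fun x => by positivity),
      ENNReal.ofReal_le_ofReal_iff (add_nonneg (integral_nonneg fun x => by positivity)
        (integral_nonneg fun x => by positivity)),
      integral_norm_add_smul_sq hg hb, integral_norm_add_smul_sq hwL hc] at h4
    linarith
  have := eq_zero_of_quadratic_nonneg hquad
  linarith

/-- The curl is formally self-adjoint: summing the three component identities and regrouping by
components of A reassembles the curl of Y. -/
theorem HasWeakCurl.integral_inner_toVec {A w : E3 → E3} (h : HasWeakCurl A w)
    (Y : Fin 3 → TestFn) :
    ∫ x, inner ℝ (w x) (toVec Y x) = ∫ x, ∑ i, A x i * curlT Y i x := by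
  obtain ⟨hA, hw, hc⟩ := h
  have hi : ∀ i j k, Integrable fun x => A x i * dd j (Y k) x := fun i j k =>
    (dd j (Y k)).integrable_mul (locallyIntegrable_coord hA i)
  have e1 : ∀ x, inner ℝ (w x) (toVec Y x) = ∑ k, w x k * Y k x := fun x => by
    simp [PiLp.inner_apply, mul_comm]
  have e2 : ∀ k, ∫ x, w x k * Y k x =
      (∫ x, A x (k + 1) * dd (k + 2) (Y k) x) - ∫ x, A x (k + 2) * dd (k + 1) (Y k) x :=
    fun k => (hc k (Y k) (Y k).2).trans (integral_sub (hi _ _ _) (hi _ _ _))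
  have e3 : ∀ i, ∫ x, A x i * curlT Y i x =
      (∫ x, A x i * dd (i + 1) (Y (i + 2)) x) - ∫ x, A x i * dd (i + 2) (Y (i + 1)) x :=
    fun i => by
      rw [← integral_sub (hi _ _ _) (hi _ _ _)]
      simp only [curlT, TestFn.sub_apply, mul_sub]
  simp only [e1]
  rw [integral_finsetSum _ fun k _ => (Y k).integrable_mul (locallyIntegrable_coord hw k),
    integral_finsetSum _ fun i _ => (curlT Y i).integrable_mul (locallyIntegrable_coord hA i)]
  simp only [e2, e3, Fin.sum_univ_three, Fin.isValue, Fin.reduceAdd, zero_add]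
  ring

theorem integral_inner_appliedField (h₀ : ℝ) (X : Fin 3 → TestFn) :
    ∫ x, inner ℝ (appliedField h₀) (toVec (curlT X) x) = 0 := by
  have e : ∀ x, inner ℝ (appliedField h₀) (toVec (curlT X) x) = h₀ * curlT X 2 x := fun x => by
    simp [appliedField, EuclideanSpace.inner_single_left]
  simp only [e, integral_const_mul, curlT, TestFn.sub_apply]
  rw [integral_sub (dd _ _).integrable (dd _ _).integrable, integral_dd, integral_dd]
  simp

/-- The Euler–Lagrange equation in the form of a fourth order equation for the potential. -/
theorem IsMinimizer.integral_mul_lap_lap {D : Set E3} (hD : Bornology.IsBounded D) {h₀ : ℝ}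
    {v : E3 → E2} {A : E3 → E3} (hmin : IsMinimizer D h₀ v A) (i : Fin 2) (φ : TestFn) :
    (∫ x, A x i.castSucc * lap (lap φ) x) +
      ∫ x in D, (v x i - A x i.castSucc) * lap φ x = 0 := by
  obtain ⟨⟨-, w, hw, hwL⟩, hdiv, -⟩ := hmin.2.1
  -- Variation generated by Ψ = φ eᵢ: the field v moves by the horizontal gradient of div Ψ and A by
  -- curl curl Ψ. In v - Â the gradients cancel and only Δφ in direction i is left.
  set Ψ : Fin 3 → TestFn := fun j => if j = i.castSucc then φ else 0 with hΨ
  set X := curlT (curlT Ψ) with hX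
  have hA := hw.1
  have hEL := euler_lagrange hD hmin hw hwL (divT Ψ) (X := X) (divT_curlT _)
  have e1 : ∀ x, inner ℝ (v x - hat (A x)) (gradHat (divT Ψ) x - hat (toVec X x)) =
      (v x i - A x i.castSucc) * lap φ x := by
    intro x
    have h0 : dd 0 (divT Ψ) - X 0 = lap (Ψ 0) := by rw [hX, curlT_curlT]; abel
    have h1 : dd 1 (divT Ψ) - X 1 = lap (Ψ 1) := by rw [hX, curlT_curlT]; abel
    have e : gradHat (divT Ψ) x - hat (toVec X x) = !₂[lap (Ψ 0) x, lap (Ψ 1) x] := by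
      rw [← h0, ← h1]
      ext j; fin_cases j <;> simp [gradHat, hat]
    rw [e, PiLp.inner_apply, Fin.sum_univ_two]
    fin_cases i <;> simp [hat, hΨ, mul_comm]
  have i1 : Integrable fun x => inner ℝ (w x) (toVec (curlT X) x) := by
    have e : ∀ x, inner ℝ (w x) (toVec (curlT X) x) = ∑ k, w x k * curlT X k x := fun x => by
      simp [PiLp.inner_apply, mul_comm]
    simp only [e]
    exact integrable_finsetSum _ fun k _ =>
      (curlT X k).integrable_mul (locallyIntegrable_coord hw.2.1 k)
  have i2 : Integrable fun x => inner ℝ (appliedField h₀) (toVec (curlT X) x) :=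
    memLp_one_iff_integrable.1 ((memLp_toVec (curlT X) 1).const_inner _)
  have e2 : ∫ x, inner ℝ (w x - appliedField h₀) (toVec (curlT X) x) =
      ∫ x, A x i.castSucc * lap (lap φ) x := by
    simp only [inner_sub_left]
    rw [integral_sub i1 i2, integral_inner_appliedField, sub_zero, hw.integral_inner_toVec]
    -- The fourfold curl of Ψ is Δ²Ψ minus a gradient, and that gradient integrates to zero against
    -- the divergence-free A.
    have e : ∀ x, ∑ j, A x j * curlT (curlT X) j x =
        A x i.castSucc * lap (lap φ) x - ∑ j, A x j * dd j (lap (divT Ψ)) x := fun x => by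
      simp only [hX, curlT_curlT_curlT_curlT, TestFn.sub_apply, mul_sub, Finset.sum_sub_distrib]
      congr 1
      rw [Finset.sum_eq_single i.castSucc]
      · simp [hΨ]
      · intro j _ hj
        simp [hΨ, hj]
      · simp
    simp only [e]
    rw [integral_sub ((lap (lap φ)).integrable_mul (locallyIntegrable_coord hA _))
      (integrable_finsetSum _ fun j _ => (dd j _).integrable_mul (locallyIntegrable_coord hA j))]
    have := hdiv (lap (divT Ψ)) (lap (divT Ψ)).2
    simp only [partialD_eq_dd (lap (divT Ψ)).2] at this
    rw [this, sub_zero]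
  rw [e2] at hEL
  simp only [e1] at hEL
  rw [add_comm]
  exact hEL

/-- Linear functions are harmonic, so subtracting h₀ times a horizontal component of `refField` does
not affect the fourth order equation. -/
theorem integral_clm_mul_lap (l : E3 →L[ℝ] ℝ) (φ : TestFn) : ∫ x, l x * lap φ x = 0 := by
  have hj : ∀ j, ∫ x, l x * dd j (dd j φ) x = 0 := fun j => by
    rw [integral_mul_dd l.contDiff]
    have : partialD j (fun x => l x) = fun _ => l (EuclideanSpace.single j 1) := by
      ext x; simp [partialD]
    rw [this, integral_const_mul, integral_dd, mul_zero, neg_zero]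
  simp only [lap_apply, Finset.mul_sum]
  rw [integral_finsetSum _ fun j _ => (dd j (dd j φ)).integrable_mul
    l.continuous.locallyIntegrable]
  simp [hj]

theorem exists_clm_refField (i : Fin 2) :
    ∃ l : E3 →L[ℝ] ℝ, ∀ x, refField x i.castSucc = l x := by
  fin_cases i
  · refine ⟨(-(1 / 2) : ℝ) • EuclideanSpace.proj 1, fun x => ?_⟩
    simp [refField]; ring
  · refine ⟨(1 / 2 : ℝ) • EuclideanSpace.proj 0, fun x => ?_⟩
    simp [refField]; ring

/-! ### Representation by the Newtonian potential -/

/-- Averages over large balls, tested against a function in `L⁶`, tend to zero. -/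
theorem tendsto_integral_mul_avg {u : E3 → ℝ} (hu : MemLp u 6) (ψ : TestFn) :
    Tendsto (fun n : ℕ => ∫ x, u x * conv (integrable_avgKernel (Nat.cast_add_one_pos (α := ℝ) n))
      (hasCompactSupport_avgKernel (Nat.cast_add_one_pos (α := ℝ) n)) ψ x) atTop (𝓝 0) := by
  obtain ⟨c, hc, hb⟩ := exists_avg_bound ψ
  obtain ⟨ρ, hρ, hs⟩ := ψ.exists_radius
  -- κ R³ is the volume of the ball of radius (2 + ρ)R; this ball contains the support of the
  -- average because R ≥ 1.
  set κ : ℝ := (2 + ρ) ^ 3 * (Real.pi * 4 / 3)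
  have hκ : 0 < κ := by positivity
  have key : ∀ n : ℕ, ‖∫ x, u x * conv (integrable_avgKernel (Nat.cast_add_one_pos (α := ℝ) n))
      (hasCompactSupport_avgKernel (Nat.cast_add_one_pos (α := ℝ) n)) ψ x‖ₑ ≤
      ENNReal.ofReal (c * κ ^ (5 / 6 : ℝ) * ((n : ℝ) + 1) ^ (-(1 / 2) : ℝ)) *
        eLpNorm u 6 volume := by
    intro n
    set R : ℝ := (n : ℝ) + 1
    have hR : 0 < R := Nat.cast_add_one_pos n
    have hR1 : 1 ≤ R := by simp [R]
    set S := Metric.closedBall (0 : E3) ((2 + ρ) * R)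
    have hvol : volume S = ENNReal.ofReal (κ * R ^ 3) := by
      rw [EuclideanSpace.volume_closedBall_fin_three, ← ENNReal.ofReal_pow (by positivity),
        ← ENNReal.ofReal_mul (by positivity)]
      congr 1; simp only [κ]; ring
    -- Hölder with exponents 6 and 6/5. Together with the size R⁻³ of the average, the factor
    -- R^(5/2) produced here leaves R^(-1/2).
    have hHol : ∫⁻ x in S, ‖u x‖ₑ ≤ eLpNorm u 6 volume * ENNReal.ofReal (κ * R ^ 3) ^ (5 / 6 : ℝ) := by
      have h1 := eLpNorm_le_eLpNorm_mul_rpow_measure_univ (p := 1) (q := 6)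
        (μ := volume.restrict S) (f := u) (by norm_num) hu.1.restrict
      rw [eLpNorm_one_eq_lintegral_enorm, Measure.restrict_apply_univ, hvol] at h1
      refine h1.trans ?_
      have e : (1 / (1 : ℝ≥0∞).toReal - 1 / (6 : ℝ≥0∞).toReal) = 5 / 6 := by norm_num
      rw [e]
      gcongr
      exact Measure.restrict_le_self
    calc _ ≤ ∫⁻ x, ‖u x * conv (integrable_avgKernel hR) (hasCompactSupport_avgKernel hR) ψ x‖ₑ :=
          enorm_integral_le_lintegral_enorm _
      _ ≤ ∫⁻ x, S.indicator (fun x => ENNReal.ofReal (c * R⁻¹ ^ 3) * ‖u x‖ₑ) x := by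
          refine lintegral_mono fun x => ?_
          by_cases hx : x ∈ S
          · rw [indicator_of_mem hx, enorm_mul, mul_comm]
            gcongr
            rw [Real.enorm_eq_ofReal_abs]
            exact ENNReal.ofReal_le_ofReal (hb R hR x)
          · rw [indicator_of_notMem hx, avg_eq_zero hs hR, mul_zero, enorm_zero]
            rw [mem_closedBall_zero_iff, not_le] at hx
            nlinarith
      _ = ENNReal.ofReal (c * R⁻¹ ^ 3) * ∫⁻ x in S, ‖u x‖ₑ := by
          rw [lintegral_indicator Metric.isClosed_closedBall.measurableSet,
            lintegral_const_mul' _ _ ENNReal.ofReal_ne_top]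
      _ ≤ ENNReal.ofReal (c * R⁻¹ ^ 3) *
          (eLpNorm u 6 volume * ENNReal.ofReal (κ * R ^ 3) ^ (5 / 6 : ℝ)) := by gcongr
      _ = _ := by
          rw [ENNReal.ofReal_rpow_of_pos (by positivity), mul_comm (eLpNorm _ _ _), ← mul_assoc,
            ← ENNReal.ofReal_mul (by positivity)]
          congr 2
          rw [Real.mul_rpow hκ.le (by positivity), ← Real.rpow_natCast R 3, ← Real.rpow_mul hR.le,
            ← Real.rpow_natCast, ← Real.rpow_neg_one, ← Real.rpow_mul hR.le]
          have : R ^ (-(1 / 2) : ℝ) = R ^ (-1 * ((3 : ℕ) : ℝ)) * R ^ (((3 : ℕ) : ℝ) * (5 / 6)) := by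
            rw [← Real.rpow_add hR]; norm_num
          rw [this]; ring
  have hlim : Tendsto (fun n : ℕ => ENNReal.ofReal (c * κ ^ (5 / 6 : ℝ) *
      ((n : ℝ) + 1) ^ (-(1 / 2) : ℝ)) * eLpNorm u 6 volume) atTop (𝓝 0) := by
    have h1 : Tendsto (fun n : ℕ => ((n : ℝ) + 1) ^ (-(1 / 2) : ℝ)) atTop (𝓝 0) :=
      (tendsto_rpow_neg_atTop (by norm_num)).comp
        (tendsto_atTop_add_const_right _ _ tendsto_natCast_atTop_atTop)
    have h2 := ENNReal.tendsto_ofReal (h1.const_mul (c * κ ^ (5 / 6 : ℝ)))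
    have h3 := ENNReal.Tendsto.mul_const (b := eLpNorm u 6 volume) h2 (Or.inr hu.2.ne)
    simpa using h3
  rw [tendsto_zero_iff_enorm_tendsto_zero]
  exact tendsto_of_tendsto_of_tendsto_of_le_of_le tendsto_const_nhds hlim
    (fun _ => zero_le) key

theorem integrable_of_memLp_two {D : Set E3} (hD : Bornology.IsBounded D) {g : E3 → ℝ}
    (hg : MemLp g 2 (volume.restrict D)) : IntegrableOn g D := by
  have : IsFiniteMeasure (volume.restrict D) := ⟨by simpa using hD.measure_lt_top⟩
  exact hg.integrable (by norm_num)

/-- If ψ(x - y) is nonzero then ‖y‖ ≤ ‖x‖ + ρ ≤ R, and in that range the kernel is not yet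
truncated. -/
theorem conv_truncKernel_eq {ψ : TestFn} {ρ : ℝ} (hρ : ∀ x, ρ < ‖x‖ → ψ x = 0) {R : ℝ}
    (hR : 0 < R) {x : E3} (hx : ‖x‖ + ρ ≤ R) :
    conv (integrable_truncKernel hR) (hasCompactSupport_truncKernel hR) ψ x =
      ∫ z, newtonKernel x z * ψ z := by
  rw [conv_apply, ← integral_sub_left_eq_self (fun z => newtonKernel x z * ψ z) volume x]
  refine integral_congr_ae (Eventually.of_forall fun y => ?_)
  by_cases hy : ‖y‖ ≤ R
  · simp [newtonKernel, truncKernel_eq hR hy]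
  · have : ρ < ‖x - y‖ := by
      have := norm_sub_norm_le y x
      rw [norm_sub_rev] at this
      linarith
    simp [hρ _ this]

/-- A function in `L⁶` solving the fourth order equation is represented, in the weak sense, by the
Newtonian potential. -/
theorem integral_mul_test_eq {D : Set E3} (hD : MeasurableSet D) (hDb : Bornology.IsBounded D)
    {g u : E3 → ℝ} (hg : MemLp g 2 (volume.restrict D)) (hu : MemLp u 6)
    (h : ∀ φ : TestFn, (∫ x, u x * lap (lap φ) x) + ∫ x in D, g x * lap φ x = 0) (ψ : TestFn) :
    ∫ x, u x * ψ x = ∫ x in D, g x * ∫ z, newtonKernel x z * ψ z := by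
  have hgi := integrable_of_memLp_two hDb hg
  have hul : LocallyIntegrable u := hu.locallyIntegrable (by norm_num)
  have hgm : ∀ φ : TestFn, IntegrableOn (fun x => g x * φ x) D := fun φ => by
    obtain ⟨M, -, hM⟩ := φ.exists_bound
    exact hgi.mul_bdd φ.continuous.aestronglyMeasurable (Eventually.of_forall hM)
  let K : ℕ → TestFn → TestFn := fun n φ =>
    conv (integrable_avgKernel (Nat.cast_add_one_pos (α := ℝ) n))
      (hasCompactSupport_avgKernel (Nat.cast_add_one_pos (α := ℝ) n)) φ
  let G : ℕ → TestFn → TestFn := fun n φ =>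
    conv (integrable_truncKernel (Nat.cast_add_one_pos (α := ℝ) n))
      (hasCompactSupport_truncKernel (Nat.cast_add_one_pos (α := ℝ) n)) φ
  have hGK : ∀ n φ, lap (G n φ) = K n φ - φ := fun n φ =>
    lap_conv_truncKernel (Nat.cast_add_one_pos n) φ
  have hKlim : ∀ φ, Tendsto (fun n => ∫ x, u x * K n φ x) atTop (𝓝 0) := fun φ =>
    tendsto_integral_mul_avg hu φ
  have hgK : ∀ φ, Tendsto (fun n => ∫ x in D, g x * K n φ x) atTop (𝓝 0) := by
    intro φ
    obtain ⟨c, hc, hb⟩ := exists_avg_bound φ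
    have hlim : Tendsto (fun n : ℕ => (∫ x in D, |g x|) * (c * ((n : ℝ) + 1)⁻¹ ^ 3)) atTop
        (𝓝 0) := by
      have h1 : Tendsto (fun n : ℕ => ((n : ℝ) + 1)⁻¹) atTop (𝓝 0) :=
        (tendsto_atTop_add_const_right _ _ tendsto_natCast_atTop_atTop).inv_tendsto_atTop
      simpa using ((h1.pow 3).const_mul c).const_mul (∫ x in D, |g x|)
    refine squeeze_zero_norm (fun n => ?_) hlim
    rw [← integral_mul_const]
    refine norm_integral_le_of_norm_le (hgi.abs.mul_const _) (Eventually.of_forall fun x => ?_)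
    rw [norm_mul]
    exact mul_le_mul_of_nonneg_left (hb _ (Nat.cast_add_one_pos n) x) (abs_nonneg _)
  -- Liouville step: insert the truncated potential of φ into the fourth order equation. The left
  -- side does not depend on n, while the averages on the right tend to zero.
  have hT : ∀ φ : TestFn, (∫ x, u x * lap φ x) + ∫ x in D, g x * φ x = 0 := by
    intro φ
    have e : ∀ n, (∫ x, u x * lap φ x) + ∫ x in D, g x * φ x =
        (∫ x, u x * K n (lap φ) x) + ∫ x in D, g x * K n φ x := fun n => by
      have h1 := h (G n φ)
      have e1 : lap (lap (G n φ)) = K n (lap φ) - lap φ := by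
        rw [hGK, map_sub]; congr 1; exact lap_conv _ _ _
      rw [e1, hGK] at h1
      simp only [TestFn.sub_apply, mul_sub] at h1
      rw [integral_sub ((K n (lap φ)).integrable_mul hul) ((lap φ).integrable_mul hul),
        integral_sub (hgm _) (hgm _)] at h1
      linarith
    have hlim := (hKlim (lap φ)).add (hgK φ)
    simp only [← e, add_zero] at hlim
    exact tendsto_nhds_unique tendsto_const_nhds hlim
  obtain ⟨ρ, -, hρ⟩ := ψ.exists_radius
  obtain ⟨d, hd⟩ := hDb.exists_norm_le
  -- Second use of the truncated potential, now in the second order equation `hT`. Since D is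
  -- bounded, for large n truncation no longer affects its values on D.
  have hev : ∀ᶠ n : ℕ in atTop, ∫ x, u x * K n ψ x =
      (∫ x, u x * ψ x) - ∫ x in D, g x * ∫ z, newtonKernel x z * ψ z := by
    filter_upwards [tendsto_natCast_atTop_atTop.eventually_ge_atTop (d + ρ)] with n hn
    have h1 := hT (G n ψ)
    rw [hGK] at h1
    simp only [TestFn.sub_apply, mul_sub] at h1
    rw [integral_sub ((K n ψ).integrable_mul hul) (ψ.integrable_mul hul)] at h1
    have e : ∫ x in D, g x * G n ψ x = ∫ x in D, g x * ∫ z, newtonKernel x z * ψ z := by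
      refine setIntegral_congr_fun hD fun x hx => ?_
      have := conv_truncKernel_eq hρ (Nat.cast_add_one_pos (α := ℝ) n) (x := x)
        (by linarith [hd x hx])
      simp only [G, this]
    rw [e] at h1
    linarith
  have := tendsto_nhds_unique ((hKlim ψ).congr' hev) tendsto_const_nhds
  linarith

theorem mul_le_sq_add_sq (a b : ℝ≥0∞) : a * b ≤ a ^ 2 + b ^ 2 := by
  rcases le_total a b with h | h
  · calc a * b ≤ b * b := by gcongr
      _ = b ^ 2 := (pow_two b).symm
      _ ≤ _ := le_add_self
  · calc a * b ≤ a * a := by gcongr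
      _ = a ^ 2 := (pow_two a).symm
      _ ≤ _ := le_self_add

theorem enorm_newtonKernel_sq_le (x y : E3) : ‖newtonKernel x y‖ₑ ^ 2 ≤ prodKernel (x - y) := by
  rw [Real.enorm_of_nonneg (newtonKernel_nonneg x y),
    ← ENNReal.ofReal_pow (newtonKernel_nonneg x y)]
  exact sq_newtonKernel_le x y

/-- Fubini's theorem for the Newtonian potential tested against a test function. -/
theorem integral_newtonPotential_mul {D : Set E3} (hD : MeasurableSet D)
    (hDb : Bornology.IsBounded D) {g : E3 → ℝ} (hg : MemLp g 2 (volume.restrict D)) (ψ : TestFn) :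
    ∫ x in D, g x * ∫ z, newtonKernel x z * ψ z = ∫ z, newtonPotential D g z * ψ z := by
  have hint : Integrable (Function.uncurry fun (z x : E3) => newtonKernel z x * g x * ψ z)
      (volume.prod (volume.restrict D)) := by
    have hm : AEStronglyMeasurable (Function.uncurry fun (z x : E3) => newtonKernel z x * g x * ψ z)
        (volume.prod (volume.restrict D)) :=
      (measurable_newtonKernel.aestronglyMeasurable.mul hg.1.comp_snd).mul
        ψ.continuous.aestronglyMeasurable.comp_fst
    refine ⟨hm, ?_⟩
    obtain ⟨ρ, -, hρ⟩ := ψ.exists_radius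
    obtain ⟨M, hM⟩ := exists_sub_mem_cube (hDb.union (Metric.isBounded_closedBall (x := (0 : E3))
      (r := ρ)))
    rw [HasFiniteIntegral, lintegral_prod _ hm.enorm]
    -- Bound for ∫_D |kernel · g| from ab ≤ a² + b², uniform over z in the ball containing the
    -- support of ψ.
    set c := (∫⁻ z in cube M, prodKernel z) + eLpNorm g 2 (volume.restrict D) ^ 2
    have hc : c ≠ ⊤ := ENNReal.add_ne_top.2
      ⟨(lintegral_cube_prodKernel_lt_top M).ne, ENNReal.pow_ne_top hg.2.ne⟩
    calc _ ≤ ∫⁻ z, c * ‖ψ z‖ₑ := by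
          refine lintegral_mono fun z => ?_
          simp only [Function.uncurry, enorm_mul]
          by_cases hz : ‖z‖ ≤ ρ
          · rw [lintegral_mul_const' _ _ enorm_ne_top]
            gcongr
            calc _ ≤ ∫⁻ x in D, (prodKernel (z - x) + ‖g x‖ₑ ^ 2) := by
                  refine lintegral_mono fun x => (mul_le_sq_add_sq _ _).trans ?_
                  gcongr
                  exact enorm_newtonKernel_sq_le z x
              _ = (∫⁻ x in D, prodKernel (z - x)) + ∫⁻ x in D, ‖g x‖ₑ ^ 2 :=
                  lintegral_add_left
                    (measurable_prodKernel.comp (measurable_const.sub measurable_id)) _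
              _ ≤ c := by
                  rw [← eLpNorm_two_sq_eq]
                  refine add_le_add ?_ le_rfl
                  exact setLIntegral_prodKernel_le hD fun y hy =>
                    hM z (Or.inr (by simpa using hz)) y (Or.inl hy)
          · simp [hρ z (not_le.1 hz)]
      _ < ⊤ := by
          rw [lintegral_const_mul' _ _ hc]
          exact ENNReal.mul_lt_top hc.lt_top ψ.integrable.2
  calc ∫ x in D, g x * ∫ z, newtonKernel x z * ψ z
      = ∫ x in D, ∫ z, newtonKernel z x * g x * ψ z := by
        refine integral_congr_ae (Eventually.of_forall fun x => ?_)
        simp only [← integral_const_mul]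
        refine integral_congr_ae (Eventually.of_forall fun z => ?_)
        simp only [newtonKernel_comm x z]
        ring
    _ = ∫ z, ∫ x in D, newtonKernel z x * g x * ψ z := (integral_integral_swap hint).symm
    _ = _ := by
        refine integral_congr_ae (Eventually.of_forall fun z => ?_)
        simp only [integral_mul_const]
        rfl

/-! ### Continuity of the Newtonian potential -/

/-- Absolute continuity of the integral: the balls lie in a fixed cube on which the kernel is
integrable, and their volumes tend to zero. -/
theorem tendsto_lintegral_ball_prodKernel :
    Tendsto (fun n : ℕ => ∫⁻ z in Metric.ball (0 : E3) ((n : ℝ) + 1)⁻¹, prodKernel z) atTop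
      (𝓝 0) := by
  have hr : Tendsto (fun n : ℕ => ((n : ℝ) + 1)⁻¹) atTop (𝓝 0) :=
    (tendsto_atTop_add_const_right _ _ tendsto_natCast_atTop_atTop).inv_tendsto_atTop
  have hsub : ∀ n : ℕ, Metric.ball (0 : E3) ((n : ℝ) + 1)⁻¹ ⊆ cube 1 := by
    intro n z hz i
    rw [mem_ball_zero_iff] at hz
    have h1 : ((n : ℝ) + 1)⁻¹ ≤ 1 := inv_le_one_of_one_le₀ (by simp)
    exact (PiLp.norm_apply_le z i).trans (hz.le.trans h1)
  have hvol : Tendsto (fun n : ℕ => (volume.restrict (cube 1))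
      (Metric.ball (0 : E3) ((n : ℝ) + 1)⁻¹)) atTop (𝓝 0) := by
    have h1 : Tendsto (fun n : ℕ => volume (Metric.ball (0 : E3) ((n : ℝ) + 1)⁻¹)) atTop (𝓝 0) := by
      simp only [EuclideanSpace.volume_ball_fin_three]
      have h2 : Tendsto (fun n : ℕ => ENNReal.ofReal ((n : ℝ) + 1)⁻¹ ^ 3) atTop (𝓝 0) := by
        have := ENNReal.tendsto_ofReal hr
        rw [ENNReal.ofReal_zero] at this
        simpa using ENNReal.Tendsto.pow (n := 3) this
      simpa using ENNReal.Tendsto.mul_const h2 (Or.inr ENNReal.ofReal_ne_top)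
    exact tendsto_of_tendsto_of_tendsto_of_le_of_le tendsto_const_nhds h1 (fun _ => zero_le)
      fun n => Measure.restrict_apply_le _ _
  have := tendsto_setLIntegral_zero (μ := volume.restrict (cube 1))
    (lintegral_cube_prodKernel_lt_top 1).ne hvol
  refine this.congr fun n => ?_
  rw [Measure.restrict_restrict measurableSet_ball, inter_eq_left.2 (hsub n)]

/-- Capping the singularity at distance 1/(n + 1) gives bounded continuous kernels and hence
continuous potentials. By Cauchy–Schwarz the error is at most the L² mass of the kernel near its
pole times ‖g‖; translation makes this independent of x, so the convergence is uniform. -/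
theorem continuous_newtonPotential {D : Set E3} (hD : MeasurableSet D)
    (hDb : Bornology.IsBounded D) {g : E3 → ℝ} (hg : MemLp g 2 (volume.restrict D)) :
    Continuous (newtonPotential D g) := by
  have hgi := integrable_of_memLp_two hDb hg
  let k : ℕ → E3 → E3 → ℝ := fun n x y => 1 / (4 * Real.pi * max (dist x y) ((n : ℝ) + 1)⁻¹)
  have hden : ∀ (n : ℕ) (x y : E3), 0 < 4 * Real.pi * max (dist x y) ((n : ℝ) + 1)⁻¹ :=
    fun n x y => mul_pos (by positivity) (lt_max_of_lt_right (by positivity))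
  have hkc : ∀ n, Continuous fun p : E3 × E3 => k n p.1 p.2 := fun n =>
    continuous_const.div (by fun_prop) fun p => (hden n p.1 p.2).ne'
  have hkb : ∀ n x y, |k n x y| ≤ 1 / (4 * Real.pi * ((n : ℝ) + 1)⁻¹) := fun n x y => by
    rw [abs_of_pos (one_div_pos.2 (hden n x y))]
    exact one_div_le_one_div_of_le (by positivity)
      (mul_le_mul_of_nonneg_left (le_max_right _ _) (by positivity))
  have hint : ∀ n x, IntegrableOn (fun y => k n x y * g y) D := fun n x =>
    hgi.bdd_mul ((hkc n).comp (by fun_prop : Continuous fun y : E3 => (x, y))).aestronglyMeasurable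
      (Eventually.of_forall (hkb n x))
  have hcont : ∀ n, Continuous fun x => ∫ y in D, k n x y * g y := fun n => by
    refine continuous_of_dominated (F := fun x y => k n x y * g y)
      (bound := fun y => 1 / (4 * Real.pi * ((n : ℝ) + 1)⁻¹) * |g y|)
      (fun x => (hint n x).1) (fun x => Eventually.of_forall fun y => ?_) (hgi.abs.const_mul _)
      (Eventually.of_forall fun y => ?_)
    · rw [norm_mul]
      exact mul_le_mul_of_nonneg_right (hkb n x y) (abs_nonneg _)
    · exact ((hkc n).comp (by fun_prop : Continuous fun x : E3 => (x, y))).mul continuous_const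
  have hdiff : ∀ n x, ‖newtonPotential D g x - ∫ y in D, k n x y * g y‖ₑ ≤
      (∫⁻ z in Metric.ball (0 : E3) ((n : ℝ) + 1)⁻¹, prodKernel z) ^ (1 / 2 : ℝ) *
        (∫⁻ y in D, ‖g y‖ₑ ^ 2) ^ (1 / 2 : ℝ) := by
    intro n x
    set B := Metric.ball (0 : E3) ((n : ℝ) + 1)⁻¹
    -- The capped kernel lies between zero and the original, and equals it outside the small ball.
    -- On the diagonal, where division by zero gives `newtonKernel` the value 0, the right side is
    -- ⊤.
    have hpt : ∀ y, ‖newtonKernel x y - k n x y‖ₑ ^ 2 ≤ B.indicator prodKernel (x - y) := by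
      intro y
      by_cases hy : x - y ∈ B
      · rw [indicator_of_mem hy]
        rcases eq_or_lt_of_le (dist_nonneg (x := x) (y := y)) with h0 | h0
        · have : (x - y) 0 = 0 := by simp [dist_eq_zero.1 h0.symm]
          rw [prodKernel_of_eq_zero this]
          exact le_top
        refine le_trans ?_ (enorm_newtonKernel_sq_le x y)
        gcongr
        rw [Real.enorm_of_nonneg (newtonKernel_nonneg x y), Real.enorm_eq_ofReal_abs]
        refine ENNReal.ofReal_le_ofReal ?_
        have h1 : k n x y ≤ newtonKernel x y := one_div_le_one_div_of_le (by positivity)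
          (mul_le_mul_of_nonneg_left (le_max_left _ _) (by positivity))
        have h2 := one_div_pos.2 (hden n x y)
        rw [abs_of_nonneg (by linarith)]
        change 0 < k n x y at h2
        linarith
      · rw [indicator_of_notMem hy]
        have : ((n : ℝ) + 1)⁻¹ ≤ dist x y := by
          rw [mem_ball_zero_iff, not_lt, ← dist_eq_norm] at hy; exact hy
        simp [k, newtonKernel, max_eq_left this]
    have e : newtonPotential D g x - ∫ y in D, k n x y * g y =
        ∫ y in D, (newtonKernel x y - k n x y) * g y := by
      simp only [sub_mul]
      exact (integral_sub (integrableOn_newtonKernel_mul hD hDb hg x) (hint n x)).symm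
    rw [e]
    have hm : AEMeasurable (fun y => ‖newtonKernel x y - k n x y‖ₑ) (volume.restrict D) := by
      have h1 : Measurable (newtonKernel x) := by unfold newtonKernel; fun_prop
      have h2 : Measurable (k n x) :=
        ((hkc n).comp (by fun_prop : Continuous fun y : E3 => (x, y))).measurable
      exact (h1.sub h2).enorm.aemeasurable
    have hHol := ENNReal.lintegral_mul_le_Lp_mul_Lq (volume.restrict D)
      Real.HolderConjugate.two_two hm hg.1.enorm
    simp only [Pi.mul_apply, ENNReal.rpow_two] at hHol
    calc _ ≤ ∫⁻ y in D, ‖(newtonKernel x y - k n x y) * g y‖ₑ :=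
          enorm_integral_le_lintegral_enorm _
      _ ≤ _ := by simp only [enorm_mul]; exact hHol
      _ ≤ _ := by
          refine mul_le_mul' (ENNReal.rpow_le_rpow ?_ (by norm_num)) le_rfl
          calc _ ≤ ∫⁻ y, ‖newtonKernel x y - k n x y‖ₑ ^ 2 := setLIntegral_le_lintegral _ _
            _ ≤ ∫⁻ y, B.indicator prodKernel (x - y) := lintegral_mono hpt
            _ = ∫⁻ z, B.indicator prodKernel z := lintegral_sub_left_eq_self _ x
            _ = _ := lintegral_indicator measurableSet_ball _
  have hlim : Tendsto (fun n : ℕ =>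
      (∫⁻ z in Metric.ball (0 : E3) ((n : ℝ) + 1)⁻¹, prodKernel z) ^ (1 / 2 : ℝ) *
        (∫⁻ y in D, ‖g y‖ₑ ^ 2) ^ (1 / 2 : ℝ)) atTop (𝓝 0) := by
    have h1 := tendsto_lintegral_ball_prodKernel.ennrpow_const (1 / 2 : ℝ)
    rw [ENNReal.zero_rpow_of_pos (by norm_num)] at h1
    have htop : (∫⁻ y in D, ‖g y‖ₑ ^ 2) ^ (1 / 2 : ℝ) ≠ ⊤ := by
      refine ENNReal.rpow_ne_top_of_nonneg (by norm_num) ?_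
      rw [← eLpNorm_two_sq_eq]
      exact ENNReal.pow_ne_top hg.2.ne
    simpa using ENNReal.Tendsto.mul_const h1 (Or.inr htop)
  have hunif : TendstoUniformly (fun (n : ℕ) x => ∫ y in D, k n x y * g y)
      (newtonPotential D g) atTop := by
    rw [EMetric.tendstoUniformly_iff]
    intro ε hε
    filter_upwards [hlim.eventually (gt_mem_nhds hε)] with n hn x
    rw [edist_eq_enorm_sub]
    exact (hdiff n x).trans_lt hn
  exact hunif.continuous (Frequently.of_forall hcont)

/-- A minimizing potential differs from the reference field by the Newtonian potential of
`v - Â`. -/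
theorem IsMinimizer.ae_eq_newtonPotential {D : Set E3} (hD : MeasurableSet D)
    (hDb : Bornology.IsBounded D) {h₀ : ℝ} {v : E3 → E2} {A : E3 → E3}
    (hmin : IsMinimizer D h₀ v A) (i : Fin 2)
    (hg : MemLp (fun x => v x i - A x i.castSucc) 2 (volume.restrict D)) :
    ∀ᵐ x, newtonPotential D (fun x => v x i - A x i.castSucc) x + h₀ * refField x i.castSucc =
      A x i.castSucc := by
  obtain ⟨l, hl⟩ := exists_clm_refField i
  set g : E3 → ℝ := fun x => v x i - A x i.castSucc
  obtain ⟨⟨-, w, hw, -⟩, -, hc⟩ := hmin.2.1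
  have hu : MemLp (fun x => A x i.castSucc - h₀ * l x) 6 := by
    have := memLp_coord hc.1 i.castSucc
    simpa [hl] using this
  have hAi := locallyIntegrable_coord hw.1 i.castSucc
  have hli : LocallyIntegrable fun x : E3 => h₀ * l x :=
    (continuous_const.mul l.continuous).locallyIntegrable
  have heq : ∀ φ : TestFn, (∫ x, (A x i.castSucc - h₀ * l x) * lap (lap φ) x) +
      ∫ x in D, g x * lap φ x = 0 := by
    intro φ
    have h1 := hmin.integral_mul_lap_lap hDb i φ
    have h2 : ∫ x, h₀ * l x * lap (lap φ) x = 0 := by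
      simp only [mul_assoc, integral_const_mul, integral_clm_mul_lap, mul_zero]
    simp only [sub_mul]
    rw [integral_sub ((lap (lap φ)).integrable_mul hAi) ((lap (lap φ)).integrable_mul hli), h2,
      sub_zero]
    exact h1
  have hcont := continuous_newtonPotential hD hDb hg
  have hae := ae_eq_of_integral_contDiff_smul_eq (μ := volume)
    (hu.locallyIntegrable (by norm_num)) hcont.locallyIntegrable fun φ hφ hφc => by
      have h1 := integral_mul_test_eq hD hDb hg hu heq ⟨φ, hφ, hφc⟩
      rw [integral_newtonPotential_mul hD hDb hg] at h1
      simpa only [smul_eq_mul, mul_comm] using h1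
  filter_upwards [hae] with x hx
  rw [← hx, hl]
  ring

end LawrenceDoniach
end

/-! ### The theorem -/

open LawrenceDoniach
theorem lemma5p2 (Ω : Set E2) (hΩ : IsOpen Ω) (hΩb : Bornology.IsBounded Ω)
    (L : ℝ) (hL : 0 < L) :
    ∃ C : ℝ, 0 < C ∧
      -- fields given by a Newtonian potential
      (∀ (h₀ : ℝ) (g : E3 → ℝ), MemLp g 2 (volume.restrict (cylinder Ω L)) →
        ∀ (i : Fin 2) (u : E3 → ℝ),
          (∀ x, u x - h₀ * refField x i.castSucc = newtonPotential (cylinder Ω L) g x) →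
          (∀ α : ℝ, 1 / 2 < α → α < 1 → ∀ N : ℕ, 0 < N →
            layerError Ω L N u ≤ ENNReal.ofReal (C * (L / N) ^ (4 * α - 2)) *
              eLpNorm g 2 (volume.restrict (cylinder Ω L)) ^ 2) ∧
          Tendsto (fun N : ℕ => layerError Ω L N u) atTop (𝓝 0)) ∧
      -- minimizers of the limiting energy
      (∀ (h₀ : ℝ), 0 ≤ h₀ → ∀ (v : E3 → E2) (A : E3 → E3),
        IsMinimizer (cylinder Ω L) h₀ v A →
        ∀ i : Fin 2, ∃ u : E3 → ℝ, Continuous u ∧ (∀ᵐ x, u x = A x i.castSucc) ∧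
          MemLp (fun x => v x i - A x i.castSucc) 2 (volume.restrict (cylinder Ω L)) ∧
          (∀ α : ℝ, 1 / 2 < α → α < 1 → ∀ N : ℕ, 0 < N →
            layerError Ω L N u ≤ ENNReal.ofReal (C * (L / N) ^ (4 * α - 2)) *
              eLpNorm (fun x => v x i - A x i.castSucc) 2
                (volume.restrict (cylinder Ω L)) ^ 2) ∧
          Tendsto (fun N : ℕ => layerError Ω L N u) atTop (𝓝 0)) := by
  obtain ⟨C, hC, hbound⟩ := exists_layerError_bound hΩ hΩb hL
  have hD := (isOpen_cylinder hΩ L).measurableSet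
  have hDb := isBounded_cylinder hΩb L
  refine ⟨C, hC, hbound, fun h₀ _ v A hmin i => ?_⟩
  have hg : MemLp (fun x => v x i - A x i.castSucc) 2 (volume.restrict (cylinder Ω L)) :=
    (memLp_coord hmin.1.1 i).sub (memLp_coord (hmin.2.1.1.1.1.memLp_restrict hDb) i.castSucc)
  obtain ⟨l, hl⟩ := exists_clm_refField i
  -- The representative is the potential plus the reference field itself, so it satisfies the
  -- hypothesis of `hbound` at every point, as the traces at heights n s require.
  refine ⟨fun x => newtonPotential (cylinder Ω L) (fun x => v x i - A x i.castSucc) x +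
    h₀ * refField x i.castSucc, ?_, hmin.ae_eq_newtonPotential hD hDb i hg, hg,
    hbound h₀ _ hg i _ fun x => by ring⟩
  simp only [hl]
  exact (continuous_newtonPotential hD hDb hg).add (continuous_const.mul l.continuous)
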